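/- Let $n,p$ be integers, $\mathbf X=(\mathbf x_1,\dots,\mathbf x_p)\in\mathbb R^{n\times p}$ a deterministic design matrix, $\boldsymbol\beta\in\mathbb R^p$, $\sigma\ge 0$, and let $\mathbf y=\mathbf X\boldsymbol\beta+\boldsymbol\varepsilon$ with $\boldsymbol\varepsilon\sim N(0,\sigma^2\mathbf I_n)$. Fix $\lambda>0$ and let the penalty $\rho(\cdot;\lambda)$ be continuous and nondecreasing on $[0,\infty)$, with a continuous derivative $\dot\rho(\cdot;\lambda)$ on $(0,\infty)$ such that $\dot\rho(0+;\lambda)=\lambda$. Suppose $\rho$ is almost twice differentiable, that is, for some function $\ddot\rho(\cdot;\lambda)$, $$\dot\rho(t;\lambda)=\dot\rho(1;\lambda)+\int_1^t\ddot\rho(x;\lambda)\,dx\qquad\text{for all } t>0 .$$ For $A\subseteq\{1,\dots,p\}$ let $\mathbf X_A=(\mathbf x_j,\ j\in A)$, $\boldsymbol\Sigma_A=\mathbf X_A'\mathbf X_A/n$, $\boldsymbol\Sigma=\mathbf X'\mathbf X/n$ and $c_{\min}(\boldsymbol\Sigma_A)=\min_{\|\mathbf u\|=1}\|\boldsymbol\Sigma_A\mathbf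 u\|$. Suppose that $\boldsymbol\Sigma$ is nonsingular and that the convexity condition $$\kappa(\rho;\lambda)\equiv\sup_{0<t_1<t_2}\frac{\dot\rho(t_1;\lambda)-\dot\rho(t_2;\lambda)}{t_2-t_1}<\min_{|A|\le p}c_{\min}(\boldsymbol\Sigma_A)$$ holds. Let $$\widehat{\boldsymbol\beta}=\arg\min_{\mathbf b\in\mathbb R^p}\Big\{\frac1{2n}\|\mathbf y-\mathbf X\mathbf b\|^2+\sum_{j=1}^p\rho(|b_j|;\lambda)\Big\}$$ be the penalized least squares estimator, $\widetilde{\boldsymbol\beta}=\boldsymbol\Sigma^{-1}\mathbf X'\mathbf y/n$ the ordinary least squares estimator, $\widehat{\mathbf P}$ the matrix of the projection $\widehat{\mathbf P}\mathbf b=(b_j:\widehat\beta_j\ne0)'$, and, for $\mathbf b\in\mathbb R^p$, $\mathbf Q(\mathbf b;\lambda)=\boldsymbol\Sigma_{\{j:b_j\ne0\}}+\mathrm{diag}(\ddot\rho(|b_j|;\lambda),\ b_j\ne0)$. Then for every value of $\mathbf y$ the minimizer $\widehat{\boldsymbol\beta}$ exists and is unique; if $\sigma>0$, the matrix $\mathbf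 Q(\widehat{\boldsymbol\beta};\lambda)$ is almost surely invertible; all quantities under the expectations below are integrable (for $\sigma=0$ with the convention that the inverse of a singular matrix is $\mathbf 0$); and $$E(\widehat{\boldsymbol\beta}-\boldsymbol\beta)(\widehat{\boldsymbol\beta}-\boldsymbol\beta)'=E\Big\{(\widehat{\boldsymbol\beta}-\widetilde{\boldsymbol\beta})(\widehat{\boldsymbol\beta}-\widetilde{\boldsymbol\beta})'+\frac{2\sigma^2}{n}\widehat{\mathbf P}'\mathbf Q^{-1}(\widehat{\boldsymbol\beta};\lambda)\widehat{\mathbf P}\Big\}-\frac{\sigma^2}{n}\boldsymbol\Sigma^{-1}.$$ Moreover, let either $\widehat\sigma^2=\sigma^2$ (known variance) or, in the case $p<n$, $\widehat\sigma^2=\|\mathbf y-\mathbf X\widetilde{\boldsymbol\beta}\|^2/(n-p)$. Then for every $\mathbf a\in\mathbb R^p$, $$E\Big\{|\mathbf a'(\widehat{\boldsymbol\beta}-\widetilde{\boldsymbol\beta})|^2+\frac{2\widehat\sigma^2}{n}(\widehat{\mathbf P}\mathbf a)'\mathbf Q^{-1}(\widehat{\boldsymbol\beta};\lambda)(\widehat{\mathbf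 P}\mathbf a)-\frac{\widehat\sigma^2}{n}\mathbf a'\boldsymbol\Sigma^{-1}\mathbf a\Big\}=E|\mathbf a'(\widehat{\boldsymbol\beta}-\boldsymbol\beta)|^2,$$ and $$E\Big\{\|\widehat{\boldsymbol\beta}-\widetilde{\boldsymbol\beta}\|^2+\frac{2\widehat\sigma^2}{n}\mathrm{trace}\big(\mathbf Q^{-1}(\widehat{\boldsymbol\beta};\lambda)\big)-\frac{\widehat\sigma^2}{n}\mathrm{trace}(\boldsymbol\Sigma^{-1})\Big\}=E\|\widehat{\boldsymbol\beta}-\boldsymbol\beta\|^2 .$$ -/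

import Mathlib

open MeasureTheory ProbabilityTheory Set Filter Topology

noncomputable section

namespace PenLSE

variable {n p : ℕ}

/-- The fitted mean vector `X b`. -/
def fit (X : Matrix (Fin n) (Fin p) ℝ) (b : EuclideanSpace ℝ (Fin p)) :
    EuclideanSpace ℝ (Fin n) :=
  WithLp.toLp 2 (X.mulVec b.ofLp)

/-- The penalized squared loss `(2n)⁻¹ ‖y - X b‖² + ∑ j, ρ(|b j|)`, at a fixed penalty level; `ρ` is
the penalty function `t ↦ ρ(t; λ)` on `[0, ∞)`. -/
def penLoss (X : Matrix (Fin n) (Fin p) ℝ) (ρ : ℝ → ℝ) (y : EuclideanSpace ℝ (Fin n))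
    (b : EuclideanSpace ℝ (Fin p)) : ℝ :=
  (2 * (n : ℝ))⁻¹ * ‖y - fit X b‖ ^ 2 + ∑ j, ρ |b j|

/-- `b` is a global minimizer of the penalized loss for the data `(X, y)`. -/
def IsPenLSE (X : Matrix (Fin n) (Fin p) ℝ) (ρ : ℝ → ℝ) (y : EuclideanSpace ℝ (Fin n))
    (b : EuclideanSpace ℝ (Fin p)) : Prop :=
  ∀ b' : EuclideanSpace ℝ (Fin p), penLoss X ρ y b ≤ penLoss X ρ y b'

/-- The standing assumptions on the penalty `ρ = ρ(·; λ)`: it is continuous and nondecreasing on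
`[0, ∞)`, continuously differentiable on `(0, ∞)`, and standardized by `ρ'(0+) = λ`. -/
structure IsPenalty (ρ : ℝ → ℝ) (lam : ℝ) : Prop where
  continuousOn : ContinuousOn ρ (Ici 0)
  monotoneOn : MonotoneOn ρ (Ici 0)
  differentiableOn : DifferentiableOn ℝ ρ (Ioi 0)
  continuousOn_deriv : ContinuousOn (deriv ρ) (Ioi 0)
  tendsto_deriv : Tendsto (deriv ρ) (𝓝[>] 0) (𝓝 lam)

/-- `ρ` is almost twice differentiable on `(0, ∞)` with second derivative `ρ₂`: `ρ'` is an
indefinite integral of `ρ₂`. -/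
def IsAlmostSecondDeriv (ρ ρ₂ : ℝ → ℝ) : Prop :=
  ∀ t : ℝ, 0 < t →
    IntervalIntegrable ρ₂ volume 1 t ∧ deriv ρ t = deriv ρ 1 + ∫ x in (1 : ℝ)..t, ρ₂ x

/-- The maximum concavity `sup_{0 < t₁ < t₂} (ρ'(t₁) - ρ'(t₂)) / (t₂ - t₁)`, possibly `∞`. -/
def maxConcavity (ρ : ℝ → ℝ) : EReal :=
  ⨆ (t₁ : ℝ) (t₂ : ℝ) (_ : 0 < t₁) (_ : t₁ < t₂),
    (((deriv ρ t₁ - deriv ρ t₂) / (t₂ - t₁) : ℝ) : EReal)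

/-- The sub-design `X_A`, made of the columns of `X` with index in `A`. -/
def subDesign (X : Matrix (Fin n) (Fin p) ℝ) (A : Finset (Fin p)) : Matrix (Fin n) A ℝ :=
  X.submatrix id (fun j : A => (j : Fin p))

/-- The sub-Gram matrix `Σ_A = X_Aᵀ X_A / n`. -/
def subGram (X : Matrix (Fin n) (Fin p) ℝ) (A : Finset (Fin p)) : Matrix A A ℝ :=
  (n : ℝ)⁻¹ • ((subDesign X A).transpose * subDesign X A)

/-- The Gram matrix `Σ = Xᵀ X / n`. -/
def gram (X : Matrix (Fin n) (Fin p) ℝ) : Matrix (Fin p) (Fin p) ℝ :=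
  (n : ℝ)⁻¹ • (X.transpose * X)

/-- `c_min(M) = min_{‖u‖ = 1} ‖M u‖`, with value `∞` for the empty matrix. -/
def cMin {ι : Type*} [Fintype ι] (M : Matrix ι ι ℝ) : EReal :=
  ⨅ (u : EuclideanSpace ℝ ι) (_ : ‖u‖ = 1),
    ((‖(WithLp.toLp 2 (M.mulVec u.ofLp) : EuclideanSpace ℝ ι)‖ : ℝ) : EReal)

/-- The sparse convexity condition with rank `d`: `κ(ρ; λ) < min_{|A| ≤ d} c_min(Σ_A)`. -/
def SparseConvex (X : Matrix (Fin n) (Fin p) ℝ) (ρ : ℝ → ℝ) (d : ℕ) : Prop :=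
  maxConcavity ρ < ⨅ (A : Finset (Fin p)) (_ : A.card ≤ d), cMin (subGram X A)

/-- The selected set `{j : b j ≠ 0}`. -/
def support (b : EuclideanSpace ℝ (Fin p)) : Finset (Fin p) :=
  Finset.univ.filter fun j => b j ≠ 0

/-- `Q(b; λ) = Σ_{j : b j ≠ 0} + diag(ρ''(|b j|; λ), b j ≠ 0)`. -/
def Q (X : Matrix (Fin n) (Fin p) ℝ) (ρ₂ : ℝ → ℝ) (b : EuclideanSpace ℝ (Fin p)) :
    Matrix (support b) (support b) ℝ :=
  subGram X (support b) + Matrix.diagonal fun j : support b => ρ₂ |b j|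

/-- The matrix of the projection `c ↦ (c j : b j ≠ 0)`. -/
def proj (b : EuclideanSpace ℝ (Fin p)) : Matrix (support b) (Fin p) ℝ :=
  Matrix.of fun i j => if (i : Fin p) = j then 1 else 0

/-- The ordinary least squares estimator `Σ⁻¹ Xᵀ y / n`. -/
def olse (X : Matrix (Fin n) (Fin p) ℝ) (y : EuclideanSpace ℝ (Fin n)) :
    EuclideanSpace ℝ (Fin p) :=
  WithLp.toLp 2 ((gram X)⁻¹.mulVec ((n : ℝ)⁻¹ • X.transpose.mulVec y.ofLp))

/-- The outer product `v vᵀ`. -/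
def outer (v : EuclideanSpace ℝ (Fin p)) : Matrix (Fin p) (Fin p) ℝ :=
  Matrix.vecMulVec v.ofLp v.ofLp

/-- The estimator `s` of `σ²` is an admissible one: either the known constant `σ²`, or, if `p < n`,
the residual mean square `‖y - X β̃‖² / (n - p)` of the ordinary least squares fit. -/
def IsVarEstimator (X : Matrix (Fin n) (Fin p) ℝ) (σ : ℝ)
    (s : EuclideanSpace ℝ (Fin n) → ℝ) : Prop :=
  (∀ y, s y = σ ^ 2) ∨
    (p < n ∧ ∀ y, s y = ‖y - fit X (olse X y)‖ ^ 2 / ((n : ℝ) - (p : ℝ)))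

/-- The estimator of the mean squared error of `aᵀ β̂`, for an estimator `βh` of `β` and an estimator
`s` of `σ²`, both functions of the response vector:
`|aᵀ(β̂ - β̃)|² + (2 s / n) (P̂ a)ᵀ Q⁻¹ (P̂ a) - (s / n) aᵀ Σ⁻¹ a`. -/
def linMseEst (X : Matrix (Fin n) (Fin p) ℝ) (ρ₂ : ℝ → ℝ)
    (βh : EuclideanSpace ℝ (Fin n) → EuclideanSpace ℝ (Fin p))
    (s : EuclideanSpace ℝ (Fin n) → ℝ) (a : Fin p → ℝ) (y : EuclideanSpace ℝ (Fin n)) : ℝ :=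
  |a ⬝ᵥ (βh y - olse X y).ofLp| ^ 2
    + 2 * s y / n * (((proj (βh y)).mulVec a) ⬝ᵥ ((Q X ρ₂ (βh y))⁻¹.mulVec ((proj (βh y)).mulVec a)))
    - s y / n * (a ⬝ᵥ ((gram X)⁻¹.mulVec a))

/-- The estimator of the total mean squared error:
`‖β̂ - β̃‖² + (2 s / n) trace(Q⁻¹) - (s / n) trace(Σ⁻¹)`. -/
def totMseEst (X : Matrix (Fin n) (Fin p) ℝ) (ρ₂ : ℝ → ℝ)
    (βh : EuclideanSpace ℝ (Fin n) → EuclideanSpace ℝ (Fin p))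
    (s : EuclideanSpace ℝ (Fin n) → ℝ) (y : EuclideanSpace ℝ (Fin n)) : ℝ :=
  ‖βh y - olse X y‖ ^ 2 + 2 * s y / n * ((Q X ρ₂ (βh y))⁻¹).trace
    - s y / n * ((gram X)⁻¹).trace

/-- All entries of the random matrix `M` are integrable. -/
def MatIntegrable {Ω : Type*} [MeasurableSpace Ω] (P : Measure Ω)
    (M : Ω → Matrix (Fin p) (Fin p) ℝ) : Prop :=
  ∀ i j, Integrable (fun ω => M ω i j) P

/-- The entrywise expectation of a random matrix. -/
def matExp {Ω : Type*} [MeasurableSpace Ω] (P : Measure Ω)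
    (M : Ω → Matrix (Fin p) (Fin p) ℝ) : Matrix (Fin p) (Fin p) ℝ :=
  Matrix.of fun i j => ∫ ω, M ω i j ∂P

end PenLSE

end

open PenLSE

/-! Let `k < c` separate the maximum concavity of the penalty from the smallest eigenvalue of `Σ`.
The penalized loss is then strongly convex with modulus `c - k`. Hence the minimizer exists, is
unique, and is a strongly monotone Lipschitz function of the response
(`IsPenLSE.mul_norm_sub_sq_le`, `lipschitzWith_of_isPenLSE`).

Since `β̃ - β` is linear in the noise, Stein's identity for Lipschitz functions
(`integral_mul_inner_stdGaussian`) turns the cross moments of `β̂ - β` and `β̃ - β` into `σ²/n`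
times the mean of a Jacobian `J`, made of the derivatives of `β̂` along the vectors `X Σ⁻¹ e_k`.
Expanding `(β̂ - β̃)(β̂ - β̃)ᵀ` then gives the matrix identity with `J + Jᵀ` in place of `2 P̂ᵀ Q⁻¹
P̂`.

It remains to see that `J = P̂ᵀ Q⁻¹ P̂` almost everywhere, by differentiating the first order
conditions on the support (`ae_isUnit_det_Q_and_sandwich_eq`). The difficulty is that `ρ'` is
differentiable only off a null set `N`, which `|β̂_j|` might hit with positive probability. At
almost every response where it does, `β̂_j` has zero derivative along `X Σ⁻¹ e_j`
(`ae_fderiv_apply_eq_zero_of_mem_null`), and strong monotonicity forces all of `β̂` to be stationary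
in that direction. So the score, the `j`-th component of `Xᵀ(y - X β̂)/n`, has derivative one there.
But the score equals `± ρ'(|β̂_j|)` and lies in `± ρ'(N)`, which is null because `ρ'` is absolutely
continuous (`volume_image_integral_eq_zero`), so its derivative must vanish: a contradiction. The
same argument with the null set `{0}` shows that vanishing coordinates are stationary
(`ae_regular`).

For an estimated variance, `β̂` and its Jacobian depend on the response only through its projection
onto the column space, which is independent of the residual; the unbiased residual mean square
therefore factors out of the expectation. -/

namespace PenLSE

/-! ### Derivatives on preimages of null sets. -/

section NullSets

open scoped ENNReal NNReal

variable {E : Type*} [NormedAddCommGroup E] [NormedSpace ℝ E] [FiniteDimensional ℝ E]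
  [MeasurableSpace E] [BorelSpace E]

/-- A set on which `f` has invertible derivative and whose image under `f` is null, is null. -/
theorem addHaar_eq_zero_of_addHaar_image_eq_zero (μ : Measure E) [μ.IsAddHaarMeasure]
    {f : E → E} {s : Set E} {f' : E → E →L[ℝ] E}
    (hf : ∀ x ∈ s, HasFDerivWithinAt f (f' x) s x) (hdet : ∀ x ∈ s, (f' x).det ≠ 0)
    (himg : μ (f '' s) = 0) : μ s = 0 := by
  rcases s.eq_empty_or_nonempty with rfl | hne
  · simp
  have key : ∀ A : E →L[ℝ] E, ∃ δ : ℝ≥0, δ ≠ 0 ∧ (A.det ≠ 0 → ∃ m : ℝ≥0, m ≠ 0 ∧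
      ∀ (s : Set E) (f : E → E), ApproximatesLinearOn f A s δ → (m : ℝ≥0∞) * μ s ≤ μ (f '' s)) := by
    intro A
    by_cases hA : A.det = 0
    -- The partition theorem needs a radius for every linear map; the value for singular ones is
    -- irrelevant, since each piece is attached to some `f' y` with `y ∈ s`.
    · exact ⟨1, one_ne_zero, fun h => absurd hA h⟩
    have hpos : (0 : ℝ≥0∞) < ENNReal.ofReal |A.det| := by simpa using hA
    obtain ⟨m, hm0, hm⟩ := ENNReal.lt_iff_exists_nnreal_btwn.1 hpos
    obtain ⟨δ, hδ, hδ'⟩ := ((mul_le_addHaar_image_of_lt_det μ A hm).and self_mem_nhdsWithin).exists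
    exact ⟨δ, ne_of_gt hδ', fun _ => ⟨m, by simpa using hm0.ne', hδ⟩⟩
  choose r hr hrA using key
  obtain ⟨t, A, -, -, hst, happ, hA⟩ :=
    exists_partition_approximatesLinearOn_of_hasFDerivWithinAt f s f' hf r hr
  have hn : ∀ n, μ (s ∩ t n) = 0 := by
    intro n
    obtain ⟨y, hy, hAy⟩ := hA hne n
    obtain ⟨m, hm, hm'⟩ := hrA (A n) (hAy ▸ hdet y hy)
    have h1 := hm' _ f (happ n)
    have h2 : μ (f '' (s ∩ t n)) = 0 := measure_mono_null (image_mono inter_subset_left) himg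
    rw [h2, nonpos_iff_eq_zero, mul_eq_zero] at h1
    exact h1.resolve_left (by simpa using hm)
  refine measure_mono_null (t := ⋃ n, s ∩ t n) ?_ (measure_iUnion_null hn)
  rw [← inter_iUnion]
  exact subset_inter subset_rfl hst

/-- Almost everywhere on the preimage of a null set, the derivative vanishes. -/
theorem ae_fderiv_apply_eq_zero_of_mem_null (μ : Measure E) [μ.IsAddHaarMeasure]
    (f : E → ℝ) (u : E) {N : Set ℝ} (hN : volume N = 0) :
    ∀ᵐ x ∂μ, DifferentiableAt ℝ f x → f x ∈ N → fderiv ℝ f x u = 0 := by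
  by_cases hu : u = 0
  · simp [hu]
  obtain ⟨ℓ, hℓ⟩ : ∃ ℓ : E →L[ℝ] ℝ, ℓ u = 1 := by
    obtain ⟨g, hg⟩ := SeparatingDual.exists_eq_one (R := ℝ) hu
    exact ⟨g, hg⟩
  have hsurj : Function.Surjective (ℓ : E →ₗ[ℝ] ℝ) := fun c => ⟨c • u, by simp [hℓ]⟩
  have hpre : μ (ℓ ⁻¹' (toMeasurable volume N)) = 0 := by
    have h := (ae_comp_linearMap_mem_iff (ℓ : E →ₗ[ℝ] ℝ) μ volume hsurj
      (measurableSet_toMeasurable volume N).compl).2 (by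
        rw [ae_iff]; simpa using hN)
    rw [ae_iff] at h
    simp only [mem_compl_iff, not_not] at h
    exact h
  set s : Set E := {x | DifferentiableAt ℝ f x ∧ f x ∈ N ∧ fderiv ℝ f x u ≠ 0} with hs
  -- `Ψ` replaces the coordinate `ℓ` by `f`, that is, `ℓ ∘ Ψ = f`. It maps `s` into the null slab `ℓ
  -- ⁻¹' N`, and its derivative is invertible exactly where the derivative of `f` along `u` is
  -- nonzero.
  set Ψ : E → E := fun x => x + (f x - ℓ x) • u with hΨ
  set Ψ' : E → E →L[ℝ] E := fun x =>
    ContinuousLinearMap.id ℝ E + (fderiv ℝ f x - ℓ).smulRight u with hΨ'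
  have hder : ∀ x ∈ s, HasFDerivWithinAt Ψ (Ψ' x) s x := by
    intro x hx
    have h1 : HasFDerivAt Ψ (Ψ' x) x :=
      (hasFDerivAt_id x).add ((hx.1.hasFDerivAt.sub ℓ.hasFDerivAt).smul_const u)
    exact h1.hasFDerivWithinAt
  have hdet : ∀ x ∈ s, (Ψ' x).det ≠ 0 := by
    intro x hx h0
    have hinj : Function.Injective (Ψ' x : E →ₗ[ℝ] E) := by
      rw [← LinearMap.ker_eq_bot, LinearMap.ker_eq_bot']
      intro w hw
      have hw1 : w + (fderiv ℝ f x w - ℓ w) • u = 0 := by simpa [hΨ'] using hw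
      have hw2 : fderiv ℝ f x w = 0 := by
        have := congrArg ℓ hw1
        simp [hℓ] at this
        exact this
      rw [hw2, zero_sub, neg_smul, ← sub_eq_add_neg, sub_eq_zero] at hw1
      have hw3 : ℓ w = 0 := by
        rw [hw1, map_smul, smul_eq_mul, mul_eq_zero] at hw2
        exact hw2.resolve_right hx.2.2
      rw [hw1, hw3, zero_smul]
    have := LinearMap.bot_lt_ker_of_det_eq_zero (f := (Ψ' x : E →ₗ[ℝ] E)) h0
    rw [LinearMap.ker_eq_bot.2 hinj] at this
    exact lt_irrefl _ this
  have himg : μ (Ψ '' s) = 0 := by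
    refine measure_mono_null ?_ hpre
    rintro _ ⟨x, hx, rfl⟩
    apply subset_toMeasurable
    simpa [hΨ, hℓ] using hx.2.1
  have h0 := addHaar_eq_zero_of_addHaar_image_eq_zero μ hder hdet himg
  rw [ae_iff]
  refine measure_mono_null (fun x hx => ?_) h0
  simp only [mem_ofPred_eq, Classical.not_imp] at hx
  exact hx

end NullSets

/-! ### Luzin's property (N) for indefinite integrals. -/

section Luzin

open scoped ENNReal

/-- An indefinite integral of an integrable function maps null sets to null sets. -/
theorem volume_image_integral_eq_zero {f : ℝ → ℝ} (hf : Integrable f volume) (c : ℝ)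
    {N : Set ℝ} (hN : volume N = 0) :
    volume ((fun x => ∫ t in c..x, f t) '' N) = 0 := by
  set F : ℝ → ℝ := fun x => ∫ t in c..x, f t with hF
  have hfi : ∀ a b, IntervalIntegrable f volume a b := fun a b => hf.intervalIntegrable
  have hni : ∀ a b, IntervalIntegrable (fun t => |f t|) volume a b :=
    fun a b => hf.abs.intervalIntegrable
  have hdiff : ∀ a b, (∫ t in c..b, |f t|) - ∫ t in c..a, |f t| = ∫ t in a..b, |f t| :=
    fun a b => intervalIntegral.integral_interval_sub_left (hni _ _) (hni _ _)
  -- The measure of `G` is `|f| dx`, which vanishes on `N`. It dominates the outer measure `s ↦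
  -- volume (F '' s)`, so no measurability of `N` or of its image is needed.
  let G : StieltjesFunction ℝ :=
    { toFun := fun x => ∫ t in c..x, |f t|
      mono' := fun a b hab => by
        rw [← sub_nonneg, hdiff]
        exact intervalIntegral.integral_nonneg hab fun _ _ => abs_nonneg _
      right_continuous' := fun x =>
        (intervalIntegral.continuous_primitive hni c).continuousWithinAt }
  have hG : ∀ a b, G b - G a = ∫ t in a..b, |f t| := hdiff
  have hmeas : G.measure = volume.withDensity fun t => ENNReal.ofReal |f t| := by
    have : IsFiniteMeasure (volume.withDensity fun t => ENNReal.ofReal |f t|) :=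
      isFiniteMeasure_withDensity_ofReal hf.abs.2
    refine Measure.ext_of_Ioc _ _ fun a b hab => ?_
    rw [G.measure_Ioc, withDensity_apply _ measurableSet_Ioc, hG,
      intervalIntegral.integral_of_le hab.le,
      ofReal_integral_eq_lintegral_ofReal hf.abs.integrableOn (ae_of_all _ fun _ => abs_nonneg _)]
  -- On `(a, b]` the function `F` oscillates by at most `∫ |f| = G b - G a`, which bounds the length
  -- of the image.
  have hlen : ∀ s : Set ℝ, OuterMeasure.comap F volume.toOuterMeasure s ≤ G.length s := by
    intro s
    rw [StieltjesFunction.length_eq]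
    refine le_iInf fun a => le_iInf fun b => le_iInf fun hs => ?_
    -- The length only asks for a cover of `s` off the bottom elements of the line; `ℝ` has none.
    have hs' : s ⊆ Ioc a b := fun x hx => hs ⟨hx, by
      intro hb
      obtain ⟨y, hy⟩ := exists_lt x
      exact notMem_botSet_of_lt hy hb⟩
    rw [OuterMeasure.comap_apply]
    refine (measure_mono (image_mono hs')).trans ?_
    refine (Real.volume_le_diam _).trans (Metric.ediam_le ?_)
    rintro _ ⟨x, hx, rfl⟩ _ ⟨y, hy, rfl⟩
    rw [edist_dist]
    refine ENNReal.ofReal_le_ofReal ?_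
    rw [hG, Real.dist_eq]
    have h1 : F x - F y = ∫ t in y..x, f t :=
      intervalIntegral.integral_interval_sub_left (hfi _ _) (hfi _ _)
    rw [h1]
    refine (intervalIntegral.norm_integral_le_integral_norm_uIoc (f := f) (a := y) (b := x)).trans ?_
    rw [intervalIntegral.integral_of_le (hx.1.le.trans hx.2)]
    refine setIntegral_mono_set hf.abs.integrableOn (ae_of_all _ fun _ => abs_nonneg _) ?_
    refine LE.le.eventuallyLE fun t ht => ?_
    rw [mem_uIoc] at ht
    rcases ht with ht | ht
    · exact ⟨hy.1.trans ht.1, ht.2.trans hx.2⟩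
    · exact ⟨hx.1.trans ht.1, ht.2.trans hy.2⟩
  have hle : OuterMeasure.comap F volume.toOuterMeasure ≤ G.outer :=
    OuterMeasure.le_ofFunction.2 hlen
  have h0 : G.outer N = 0 := by
    have h1 : G.measure N = 0 := by
      rw [hmeas]
      exact withDensity_absolutelyContinuous _ _ hN
    rw [StieltjesFunction.measure] at h1
    exact h1
  have := hle N
  rw [h0, OuterMeasure.comap_apply] at this
  exact le_antisymm this bot_le

end Luzin

/-! ### Almost everywhere regularity of the derivative of the penalty. -/

section SecondDeriv

theorem IsAlmostSecondDeriv.intervalIntegrable {ρ ρ₂ : ℝ → ℝ} (h : IsAlmostSecondDeriv ρ ρ₂)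
    {a b : ℝ} (ha : 0 < a) (hb : 0 < b) : IntervalIntegrable ρ₂ volume a b :=
  (h a ha).1.symm.trans (h b hb).1

/-- Lebesgue differentiation on each `[1/(k+1), k+1]`; these intervals exhaust `(0, ∞)`. -/
theorem IsAlmostSecondDeriv.ae_hasDerivAt {ρ ρ₂ : ℝ → ℝ} (h : IsAlmostSecondDeriv ρ ρ₂) :
    ∀ᵐ t, 0 < t → HasDerivAt (deriv ρ) (ρ₂ t) t := by
  have h1 : ∀ k : ℕ, ∀ᵐ x, x ∈ uIcc ((k : ℝ) + 1)⁻¹ (k + 1) → ∀ c ∈ uIcc ((k : ℝ) + 1)⁻¹ (k + 1),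
      HasDerivAt (fun x => ∫ (t : ℝ) in c..x, ρ₂ t) (ρ₂ x) x := fun k =>
    (h.intervalIntegrable (by positivity) (by positivity)).ae_hasDerivAt_integral
  filter_upwards [ae_all_iff.2 h1] with t ht ht0
  obtain ⟨k, hk⟩ := exists_nat_ge (max t t⁻¹)
  have hk1 : (1 : ℝ) ≤ k + 1 := by simp
  have hk2 : ((k : ℝ) + 1)⁻¹ ≤ 1 := inv_le_one_of_one_le₀ hk1
  have hm : ∀ x, ((k : ℝ) + 1)⁻¹ ≤ x → x ≤ k + 1 → x ∈ uIcc ((k : ℝ) + 1)⁻¹ (k + 1) :=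
    fun x hx hx' => by rw [uIcc_of_le (hk2.trans hk1)]; exact ⟨hx, hx'⟩
  have h2 := ht k (hm t (by
    rw [inv_le_comm₀ (by positivity) ht0]
    linarith [le_max_right t t⁻¹]) (by linarith [le_max_left t t⁻¹])) 1 (hm 1 hk2 hk1)
  refine (h2.const_add (deriv ρ 1)).congr_of_eventuallyEq ?_
  filter_upwards [Ioi_mem_nhds ht0] with x hx
  exact (h x hx).2

/-- As `ρ₂` is integrable only away from `0` and `∞`, it is cut off to `(1/(k+1), k+1]` before
property (N) is applied, and the images are collected over `k`. -/
theorem IsAlmostSecondDeriv.volume_image_deriv {ρ ρ₂ : ℝ → ℝ} (h : IsAlmostSecondDeriv ρ ρ₂)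
    {N : Set ℝ} (hN : volume N = 0) (hpos : N ⊆ Ioi 0) : volume (deriv ρ '' N) = 0 := by
  have hsub : deriv ρ '' N ⊆ ⋃ k : ℕ, (fun x => deriv ρ 1 + x) ''
      ((fun x => ∫ t in (1 : ℝ)..x, (uIoc ((k : ℝ) + 1)⁻¹ (k + 1)).indicator ρ₂ t) '' N) := by
    rintro _ ⟨t, ht, rfl⟩
    have ht0 : 0 < t := hpos ht
    obtain ⟨k, hk⟩ := exists_nat_ge (max t t⁻¹)
    have hk1 : (1 : ℝ) ≤ k + 1 := by simp
    have hk2 : ((k : ℝ) + 1)⁻¹ ≤ 1 := inv_le_one_of_one_le₀ hk1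
    have ht1 : ((k : ℝ) + 1)⁻¹ ≤ t := by
      rw [inv_le_comm₀ (by positivity) ht0]
      linarith [le_max_right t t⁻¹]
    have ht2 : t ≤ k + 1 := by linarith [le_max_left t t⁻¹]
    refine mem_iUnion.2 ⟨k, _, ⟨t, ht, rfl⟩, ?_⟩
    simp only
    rw [(h t ht0).2]
    congr 1
    refine intervalIntegral.integral_congr_ae (ae_of_all _ fun x hx => ?_)
    refine indicator_of_mem ?_ _
    rw [uIoc_of_le (hk2.trans hk1)]
    rw [mem_uIoc] at hx
    rcases hx with hx | hx
    · exact ⟨hk2.trans_lt hx.1, hx.2.trans ht2⟩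
    · exact ⟨ht1.trans_lt hx.1, hx.2.trans hk1⟩
  refine measure_mono_null hsub (measure_iUnion_null fun k => ?_)
  rw [image_add_left, measure_preimage_add]
  refine volume_image_integral_eq_zero ?_ 1 hN
  rw [integrable_indicator_iff measurableSet_uIoc, ← intervalIntegrable_iff]
  exact h.intervalIntegrable (by positivity) (by positivity)

end SecondDeriv

end PenLSE

namespace PenLSE

/-! ### The standard Gaussian measure: density, Stein's identity, independence. -/

section Gaussian

open scoped NNReal RealInnerProductSpace

variable {E : Type*} [NormedAddCommGroup E] [InnerProductSpace ℝ E]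

variable (E) in
/-- The density of the standard Gaussian measure with respect to the Lebesgue measure. -/
noncomputable def stdGaussianDensity (x : E) : ℝ :=
  (2 * Real.pi) ^ (-(Module.finrank ℝ E : ℝ) / 2) * Real.exp (-(1 / 2) * ‖x‖ ^ 2)

theorem stdGaussianDensity_nonneg (x : E) : 0 ≤ stdGaussianDensity E x := by
  unfold stdGaussianDensity; positivity

theorem continuous_stdGaussianDensity : Continuous (stdGaussianDensity E) := by
  unfold stdGaussianDensity; fun_prop

theorem hasDerivAt_stdGaussianDensity_sub (x u : E) (t : ℝ) :
    HasDerivAt (fun t : ℝ => stdGaussianDensity E (x - t • u))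
      (⟪u, x - t • u⟫ * stdGaussianDensity E (x - t • u)) t := by
  have h1 : HasDerivAt (fun t : ℝ => x - t • u) (-u) t := by
    simpa using ((hasDerivAt_id t).smul_const u).const_sub x
  have h2 := h1.norm_sq
  have h3 := ((h2.const_mul (-(1 / 2))).exp).const_mul
    ((2 * Real.pi) ^ (-(Module.finrank ℝ E : ℝ) / 2))
  refine h3.congr_deriv ?_
  rw [stdGaussianDensity, inner_neg_right, real_inner_comm]
  ring

/-- A bound uniform in `t`, for differentiation under the integral: `‖x‖² ≤ 2‖x - t u‖² + 2‖u‖²`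
halves the exponent. -/
theorem stdGaussianDensity_sub_le (x u : E) {t : ℝ} (ht : |t| ≤ 1) :
    stdGaussianDensity E (x - t • u) ≤
      (2 * Real.pi) ^ (-(Module.finrank ℝ E : ℝ) / 2) * Real.exp (‖u‖ ^ 2 / 2) *
        Real.exp (-(1 / 4) * ‖x‖ ^ 2) := by
  rw [stdGaussianDensity, mul_assoc, ← Real.exp_add]
  gcongr
  have h1 : ‖x‖ ≤ ‖x - t • u‖ + ‖t • u‖ := by
    simpa using norm_add_le (x - t • u) (t • u)
  have h2 : ‖t • u‖ ≤ ‖u‖ := by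
    rw [norm_smul, Real.norm_eq_abs]
    exact mul_le_of_le_one_left (norm_nonneg _) ht
  have h3 : ‖x‖ ≤ ‖x - t • u‖ + ‖u‖ := h1.trans (by gcongr)
  have h4 : ‖x‖ ^ 2 ≤ (‖x - t • u‖ + ‖u‖) ^ 2 := by gcongr
  nlinarith [sq_nonneg (‖x - t • u‖ - ‖u‖)]

variable [FiniteDimensional ℝ E] [MeasurableSpace E] [BorelSpace E]

theorem integrable_exp_neg_mul_norm_sq {b : ℝ} (hb : 0 < b) :
    Integrable (fun x : E => Real.exp (-b * ‖x‖ ^ 2)) volume := by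
  have h := (GaussianFourier.integrable_cexp_neg_mul_sq_norm_add (V := E) (b := (b : ℂ))
    (by simpa using hb) 0 0).norm
  refine h.congr (ae_of_all _ fun x => ?_)
  simp only [Complex.norm_exp]
  congr 1
  simp [← Complex.ofReal_pow]

theorem integrable_stdGaussianDensity : Integrable (stdGaussianDensity E) volume :=
  (integrable_exp_neg_mul_norm_sq (by norm_num)).const_mul _

theorem stdGaussian_eq_withDensity :
    stdGaussian E = volume.withDensity fun x => ENNReal.ofReal (stdGaussianDensity E x) := by
  have : IsFiniteMeasure (volume.withDensity fun x => ENNReal.ofReal (stdGaussianDensity E x)) :=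
    isFiniteMeasure_withDensity_ofReal integrable_stdGaussianDensity.2
  refine Measure.ext_of_charFun (funext fun t => ?_)
  rw [charFun_stdGaussian, charFun_apply,
    integral_withDensity_eq_integral_toReal_smul
      (continuous_stdGaussianDensity.measurable.ennreal_ofReal) (by simp)]
  have h := GaussianFourier.integral_cexp_neg_mul_sq_norm_add (V := E) (b := (1 / 2 : ℂ))
    (by norm_num) Complex.I t
  have hpi : (0 : ℝ) < 2 * Real.pi := by positivity
  have hint : ∀ x : E, (ENNReal.ofReal (stdGaussianDensity E x)).toReal •
      Complex.exp ((⟪x, t⟫ : ℝ) * Complex.I) =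
      (((2 * Real.pi) ^ (-(Module.finrank ℝ E : ℝ) / 2) : ℝ) : ℂ) *
        Complex.exp (-(1 / 2 : ℂ) * ‖x‖ ^ 2 + Complex.I * ⟪t, x⟫) := by
    intro x
    rw [ENNReal.toReal_ofReal (stdGaussianDensity_nonneg x), stdGaussianDensity, Complex.real_smul,
      real_inner_comm x t, Complex.exp_add]
    push_cast
    rw [mul_comm Complex.I]
    ring
  simp_rw [hint]
  rw [integral_const_mul, h]
  have h1 : ((Real.pi : ℂ) / (1 / 2)) ^ ((Module.finrank ℝ E : ℂ) / 2) =
      (((2 * Real.pi) ^ ((Module.finrank ℝ E : ℝ) / 2) : ℝ) : ℂ) := by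
    rw [Complex.ofReal_cpow hpi.le]
    push_cast
    congr 1
    ring
  rw [h1, ← mul_assoc, ← Complex.ofReal_mul, ← Real.rpow_add hpi, ← add_div, neg_add_cancel, zero_div,
    Real.rpow_zero, Complex.ofReal_one, one_mul, Complex.I_sq]
  congr 1
  ring

theorem stdGaussian_absolutelyContinuous : stdGaussian E ≪ volume := by
  rw [stdGaussian_eq_withDensity]
  exact withDensity_absolutelyContinuous _ _

theorem integral_stdGaussian (f : E → ℝ) :
    ∫ x, f x ∂(stdGaussian E) = ∫ x, f x * stdGaussianDensity E x := by
  rw [stdGaussian_eq_withDensity, integral_withDensity_eq_integral_toReal_smul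
      (continuous_stdGaussianDensity.measurable.ennreal_ofReal) (by simp)]
  congr 1 with x
  rw [ENNReal.toReal_ofReal (stdGaussianDensity_nonneg x), smul_eq_mul, mul_comm]

theorem memLp_two_of_lipschitzWith {F : Type*} [NormedAddCommGroup F] [SecondCountableTopology F]
    [MeasurableSpace F] [BorelSpace F] {C : ℝ≥0} {f : E → F} (hf : LipschitzWith C f) :
    MemLp f 2 (stdGaussian E) := by
  have h1 : MemLp (id : E → E) 2 (stdGaussian E) := IsGaussian.memLp_two_id
  have h2 : MemLp (fun x : E => ‖f 0‖ + C * ‖x‖) 2 (stdGaussian E) :=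
    MemLp.add (f := fun _ => ‖f 0‖) (memLp_const ‖f 0‖) (MemLp.const_mul h1.norm (C : ℝ))
  refine h2.mono hf.continuous.measurable.aestronglyMeasurable (ae_of_all _ fun x => ?_)
  have h3 := hf.norm_sub_le x 0
  rw [sub_zero] at h3
  have h4 : ‖f x‖ ≤ ‖f 0‖ + ‖f x - f 0‖ := by
    simpa using norm_add_le (f 0) (f x - f 0)
  rw [Real.norm_eq_abs]
  exact (h4.trans (by linarith)).trans (le_abs_self _)

/-- **Stein's identity** for Lipschitz functions of a standard Gaussian vector. -/
theorem integral_mul_inner_stdGaussian {C : ℝ≥0} {f : E → ℝ} (hf : LipschitzWith C f) (u : E) :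
    ∫ x, f x * ⟪u, x⟫ ∂(stdGaussian E) = ∫ x, fderiv ℝ f x u ∂(stdGaussian E) := by
  have hdiff : ∀ᵐ x ∂(stdGaussian E), DifferentiableAt ℝ f x :=
    stdGaussian_absolutelyContinuous.ae_le hf.ae_differentiableAt
  have hline : ∀ (x : E) (t : ℝ), HasDerivAt (fun t : ℝ => x + t • u) u t := fun x t => by
    simpa using ((hasDerivAt_id t).smul_const u).const_add x
  -- The same function of `t` is differentiated twice at `0`: here on `f`, using Rademacher's
  -- theorem, and in `h3` on the density, after a translation of the integration variable.
  have h1 : HasDerivAt (fun t : ℝ => ∫ x, f (x + t • u) ∂(stdGaussian E))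
      (∫ x, fderiv ℝ f x u ∂(stdGaussian E)) 0 := by
    refine (hasDerivAt_integral_of_dominated_loc_of_lip (F := fun t x => f (x + t • u))
      (bound := fun _ => C * ‖u‖) (s := univ) univ_mem ?_ ?_ ?_ ?_ ?_ ?_).2
    · refine Eventually.of_forall fun t => ?_
      exact (hf.continuous.comp (by fun_prop)).measurable.aestronglyMeasurable
    · simpa using (memLp_two_of_lipschitzWith hf).integrable (by norm_num)
    · exact (measurable_fderiv_apply_const ℝ f u).aestronglyMeasurable
    · refine ae_of_all _ fun x => LipschitzWith.lipschitzOnWith ?_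
      refine LipschitzWith.of_dist_le_mul fun s t => ?_
      refine (hf.dist_le_mul _ _).trans (le_of_eq ?_)
      rw [dist_add_left, dist_eq_norm, ← sub_smul, norm_smul, Real.coe_nnabs,
        abs_of_nonneg (by positivity), dist_eq_norm]
      ring
    · exact integrable_const _
    · filter_upwards [hdiff] with x hx
      have hx' : HasFDerivAt f (fderiv ℝ f x) (x + (0 : ℝ) • u) := by simpa using hx.hasFDerivAt
      exact hx'.comp_hasDerivAt (0 : ℝ) (hline x 0)
  have h2 : (fun t : ℝ => ∫ x, f (x + t • u) ∂(stdGaussian E)) =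
      fun t : ℝ => ∫ x, f x * stdGaussianDensity E (x - t • u) := by
    funext t
    rw [integral_stdGaussian, ← integral_sub_right_eq_self _ (t • u)]
    simp
  rw [h2] at h1
  have hfb : ∀ x, |f x| ≤ (|f 0| + C) * (1 + ‖x‖) := by
    intro x
    have h3 := hf.norm_sub_le x 0
    rw [sub_zero, Real.norm_eq_abs] at h3
    have h4 : |f x| ≤ |f 0| + |f x - f 0| := by simpa using abs_add_le (f 0) (f x - f 0)
    nlinarith [mul_nonneg (abs_nonneg (f 0)) (norm_nonneg x), C.coe_nonneg]
  set c : ℝ := (2 * Real.pi) ^ (-(Module.finrank ℝ E : ℝ) / 2) * Real.exp (‖u‖ ^ 2 / 2) with hc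
  have hc0 : 0 ≤ c := by positivity
  have h3 : HasDerivAt (fun t : ℝ => ∫ x, f x * stdGaussianDensity E (x - t • u))
      (∫ x, f x * (⟪u, x - (0 : ℝ) • u⟫ * stdGaussianDensity E (x - (0 : ℝ) • u))) 0 := by
    refine (hasDerivAt_integral_of_dominated_loc_of_deriv_le
      (F := fun t x => f x * stdGaussianDensity E (x - t • u))
      (F' := fun t x => f x * (⟪u, x - t • u⟫ * stdGaussianDensity E (x - t • u)))
      (bound := fun x => (|f 0| + C) * (‖u‖ * (1 + ‖u‖)) * c * 16 *
        Real.exp (-(1 / 8) * ‖x‖ ^ 2))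
      (s := Metric.ball 0 1) (Metric.ball_mem_nhds _ one_pos) ?_ ?_ ?_ ?_ ?_ ?_).2
    · refine Eventually.of_forall fun t => ?_
      exact (hf.continuous.mul (continuous_stdGaussianDensity.comp
        (by fun_prop))).measurable.aestronglyMeasurable
    · have := ((memLp_two_of_lipschitzWith hf).integrable (by norm_num))
      rw [stdGaussian_eq_withDensity, integrable_withDensity_iff_integrable_smul'
        (continuous_stdGaussianDensity.measurable.ennreal_ofReal) (by simp)] at this
      refine this.congr (ae_of_all _ fun x => ?_)
      simp only [zero_smul, sub_zero, smul_eq_mul]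
      rw [ENNReal.toReal_ofReal (stdGaussianDensity_nonneg x), mul_comm]
    · exact (hf.continuous.mul ((by fun_prop : Continuous fun x : E => ⟪u, x - (0 : ℝ) • u⟫).mul
        (continuous_stdGaussianDensity.comp (by fun_prop)))).measurable.aestronglyMeasurable
    · refine ae_of_all _ fun x t ht => ?_
      have ht1 : |t| ≤ 1 := by
        rw [mem_ball_zero_iff, Real.norm_eq_abs] at ht
        exact ht.le
      have hi : |⟪u, x - t • u⟫| ≤ ‖u‖ * (1 + ‖u‖) * (1 + ‖x‖) := by
        refine (abs_real_inner_le_norm _ _).trans ?_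
        have h4 : ‖x - t • u‖ ≤ ‖x‖ + ‖u‖ := by
          refine (norm_sub_le _ _).trans ?_
          gcongr
          rw [norm_smul, Real.norm_eq_abs]
          exact mul_le_of_le_one_left (norm_nonneg _) ht1
        rw [mul_assoc]
        refine mul_le_mul_of_nonneg_left (h4.trans ?_) (norm_nonneg _)
        nlinarith [mul_nonneg (norm_nonneg u) (norm_nonneg x)]
      have hg := stdGaussianDensity_sub_le x u ht1
      rw [← hc] at hg
      have hexp : (1 + ‖x‖) * (1 + ‖x‖) * Real.exp (-(1 / 4) * ‖x‖ ^ 2) ≤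
          16 * Real.exp (-(1 / 8) * ‖x‖ ^ 2) := by
        have h5 : Real.exp (-(1 / 4) * ‖x‖ ^ 2) * Real.exp (1 / 8 * ‖x‖ ^ 2) =
            Real.exp (-(1 / 8) * ‖x‖ ^ 2) := by
          rw [← Real.exp_add]; congr 1; ring
        -- `(1 + r)² ≤ 2 + 2r² ≤ 16 (1 + r²/8)`.
        have h6 : (1 + ‖x‖) * (1 + ‖x‖) ≤ 16 * Real.exp (1 / 8 * ‖x‖ ^ 2) := by
          nlinarith [Real.add_one_le_exp (1 / 8 * ‖x‖ ^ 2), sq_nonneg (‖x‖ - 1)]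
        rw [← h5]
        nlinarith [Real.exp_pos (-(1 / 4) * ‖x‖ ^ 2)]
      rw [norm_mul, norm_mul, Real.norm_eq_abs, Real.norm_eq_abs, Real.norm_eq_abs,
        abs_of_nonneg (stdGaussianDensity_nonneg _)]
      calc |f x| * (|⟪u, x - t • u⟫| * stdGaussianDensity E (x - t • u))
          ≤ ((|f 0| + C) * (1 + ‖x‖)) * ((‖u‖ * (1 + ‖u‖) * (1 + ‖x‖)) *
              (c * Real.exp (-(1 / 4) * ‖x‖ ^ 2))) := by
            gcongr
            · exact mul_nonneg (abs_nonneg _) (stdGaussianDensity_nonneg _)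
            · exact hfb x
            · exact stdGaussianDensity_nonneg _
        _ = (|f 0| + C) * (‖u‖ * (1 + ‖u‖)) * c *
              ((1 + ‖x‖) * (1 + ‖x‖) * Real.exp (-(1 / 4) * ‖x‖ ^ 2)) := by ring
        _ ≤ (|f 0| + C) * (‖u‖ * (1 + ‖u‖)) * c * (16 * Real.exp (-(1 / 8) * ‖x‖ ^ 2)) := by
            gcongr
        _ = _ := by ring
    · exact (integrable_exp_neg_mul_norm_sq (by norm_num)).const_mul _
    · exact ae_of_all _ fun x t _ => (hasDerivAt_stdGaussianDensity_sub x u t).const_mul (f x)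
  have h4 := h3.unique h1
  rw [← h4, integral_stdGaussian]
  congr 1 with x
  rw [zero_smul, sub_zero, mul_assoc]

/-- Uncorrelated linear images of a standard Gaussian vector are independent. -/
theorem indepFun_stdGaussian {F G : Type*} [NormedAddCommGroup F] [InnerProductSpace ℝ F]
    [FiniteDimensional ℝ F] [MeasurableSpace F] [BorelSpace F]
    [NormedAddCommGroup G] [InnerProductSpace ℝ G]
    [FiniteDimensional ℝ G] [MeasurableSpace G] [BorelSpace G]
    (A : E →L[ℝ] F) (B : E →L[ℝ] G) (h : ∀ z, A (B.adjoint z) = 0) :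
    IndepFun A B (stdGaussian E) := by
  have hg : HasGaussianLaw (fun x => (A x, B x)) (stdGaussian E) := by
    have : HasGaussianLaw (id : E → E) (stdGaussian E) := ⟨by rw [Measure.map_id]; infer_instance⟩
    exact this.map (A.prod B)
  refine hg.indepFun_of_covariance_inner fun x z => ?_
  have h1 : (fun ω => ⟪x, A ω⟫) = fun ω => ⟪A.adjoint x, ω⟫ := by
    funext ω; rw [ContinuousLinearMap.adjoint_inner_left]
  have h2 : (fun ω => ⟪z, B ω⟫) = fun ω => ⟪B.adjoint z, ω⟫ := by
    funext ω; rw [ContinuousLinearMap.adjoint_inner_left]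
  rw [h1, h2, ← covarianceBilin_apply_eq_cov IsGaussian.memLp_two_id, covarianceBilin_stdGaussian,
    innerSL_apply_apply, ContinuousLinearMap.adjoint_inner_left, h, inner_zero_right]

/-- Stein's identity for a linear function, whose derivative is constant. -/
theorem integral_inner_mul_inner_stdGaussian (u v : E) :
    ∫ x, ⟪v, x⟫ * ⟪u, x⟫ ∂(stdGaussian E) = ⟪u, v⟫ := by
  have h := integral_mul_inner_stdGaussian (innerSL ℝ v).lipschitz u
  simp only [ContinuousLinearMap.fderiv, innerSL_apply_apply] at h
  rw [h, integral_const]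
  simp [real_inner_comm]

end Gaussian

end PenLSE

namespace PenLSE

open scoped Matrix RealInnerProductSpace

variable {n p : ℕ}

/-! ### Quadratic forms of the Gram matrix. -/

section Design

variable (X : Matrix (Fin n) (Fin p) ℝ)

/-- The fitted mean vector as a continuous linear map of the coefficient vector. -/
noncomputable def fitL : EuclideanSpace ℝ (Fin p) →L[ℝ] EuclideanSpace ℝ (Fin n) :=
  LinearMap.toContinuousLinearMap (Matrix.toLpLin 2 2 X)

@[simp] theorem fitL_apply (b : EuclideanSpace ℝ (Fin p)) : fitL X b = fit X b := rfl

theorem norm_fit_le (b : EuclideanSpace ℝ (Fin p)) : ‖fit X b‖ ≤ ‖fitL X‖ * ‖b‖ := by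
  rw [← fitL_apply]
  exact (fitL X).le_opNorm b

theorem inner_eq_dotProduct {ι : Type*} [Fintype ι] (x y : EuclideanSpace ℝ ι) :
    ⟪x, y⟫ = x.ofLp ⬝ᵥ y.ofLp := by
  simp [PiLp.inner_apply, dotProduct, mul_comm]

theorem inner_fit (v : EuclideanSpace ℝ (Fin n)) (b : EuclideanSpace ℝ (Fin p)) :
    ⟪v, fit X b⟫ = Xᵀ.mulVec v.ofLp ⬝ᵥ b.ofLp := by
  rw [inner_eq_dotProduct, fit, Matrix.dotProduct_mulVec, Matrix.mulVec_transpose]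

theorem inner_fit_fit (a b : EuclideanSpace ℝ (Fin p)) :
    (n : ℝ)⁻¹ * ⟪fit X a, fit X b⟫ = (gram X).mulVec a.ofLp ⬝ᵥ b.ofLp := by
  rw [inner_fit, fit, Matrix.mulVec_mulVec, gram, Matrix.smul_mulVec, smul_dotProduct, smul_eq_mul]

theorem norm_fit_sq (b : EuclideanSpace ℝ (Fin p)) :
    (n : ℝ)⁻¹ * ‖fit X b‖ ^ 2 = (gram X).mulVec b.ofLp ⬝ᵥ b.ofLp := by
  rw [← inner_fit_fit, real_inner_self_eq_norm_sq]

theorem gram_isHermitian : (gram X).IsHermitian := by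
  rw [Matrix.IsHermitian, Matrix.conjTranspose_eq_transpose_of_trivial, gram,
    Matrix.transpose_smul, Matrix.transpose_mul, Matrix.transpose_transpose]

theorem gram_transpose : (gram X)ᵀ = gram X := gram_isHermitian X

theorem inv_gram_transpose : ((gram X)⁻¹)ᵀ = (gram X)⁻¹ := by
  rw [Matrix.transpose_nonsing_inv, gram_transpose]

/-- If `‖Σ u‖ ≥ c ‖u‖` for all `u`, then the quadratic form of `Σ` is at least `c`. -/
theorem mul_norm_sq_le_gram {c : ℝ}
    (h : ∀ u : EuclideanSpace ℝ (Fin p),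
      c * ‖u‖ ≤ ‖(WithLp.toLp 2 ((gram X).mulVec u.ofLp) : EuclideanSpace ℝ (Fin p))‖)
    (b : EuclideanSpace ℝ (Fin p)) : c * ‖b‖ ^ 2 ≤ (gram X).mulVec b.ofLp ⬝ᵥ b.ofLp := by
  have hA := gram_isHermitian X
  set e := hA.eigenvectorBasis with he
  have hev : ∀ i, (gram X).mulVec (e i).ofLp = hA.eigenvalues i • (e i).ofLp :=
    fun i => hA.mulVec_eigenvectorBasis i
  have hn : ∀ i, ‖e i‖ = 1 := fun i => e.orthonormal.1 i
  have hl : ∀ i, c ≤ hA.eigenvalues i := by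
    intro i
    have h1 := h (e i)
    rw [hev, WithLp.toLp_smul, norm_smul, WithLp.toLp_ofLp, hn, mul_one, mul_one] at h1
    have h2 := norm_fit_sq X (e i)
    rw [hev, smul_dotProduct, ← inner_eq_dotProduct, real_inner_self_eq_norm_sq, hn] at h2
    -- The hypothesis at an eigenvector bounds only the modulus of the eigenvalue; semidefiniteness
    -- removes it.
    have h3 : 0 ≤ hA.eigenvalues i := by
      have : 0 ≤ (n : ℝ)⁻¹ * ‖fit X (e i)‖ ^ 2 := by positivity
      rw [h2] at this
      simpa using this
    rwa [Real.norm_eq_abs, abs_of_nonneg h3] at h1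
  have h4 : (gram X).mulVec b.ofLp ⬝ᵥ b.ofLp = ∑ i, hA.eigenvalues i * ⟪e i, b⟫ ^ 2 := by
    have h5 := e.sum_inner_mul_inner (WithLp.toLp 2 ((gram X).mulVec b.ofLp)) b
    rw [inner_eq_dotProduct] at h5
    rw [show (gram X).mulVec b.ofLp ⬝ᵥ b.ofLp =
      (WithLp.toLp 2 ((gram X).mulVec b.ofLp) : EuclideanSpace ℝ (Fin p)).ofLp ⬝ᵥ b.ofLp from rfl,
      ← h5]
    refine Finset.sum_congr rfl fun i _ => ?_
    have h6 : ⟪(WithLp.toLp 2 ((gram X).mulVec b.ofLp) : EuclideanSpace ℝ (Fin p)), e i⟫ =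
        hA.eigenvalues i * ⟪e i, b⟫ := by
      rw [inner_eq_dotProduct, inner_eq_dotProduct]
      change (gram X).mulVec b.ofLp ⬝ᵥ (e i).ofLp = _
      rw [dotProduct_comm, Matrix.dotProduct_mulVec, ← Matrix.mulVec_transpose, gram_transpose, hev,
        smul_dotProduct, smul_eq_mul]
    rw [h6]
    ring
  have h7 : ‖b‖ ^ 2 = ∑ i, ⟪e i, b⟫ ^ 2 := by
    rw [← real_inner_self_eq_norm_sq, ← e.sum_inner_mul_inner b b]
    refine Finset.sum_congr rfl fun i _ => ?_
    rw [real_inner_comm]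
    ring
  rw [h4, h7, Finset.mul_sum]
  exact Finset.sum_le_sum fun i _ => mul_le_mul_of_nonneg_right (hl i) (sq_nonneg _)

/-- Normalization of `u`, together with the passage from indices in the subtype of `Finset.univ` to
`Fin p`. -/
theorem mul_norm_le_norm_gram_mulVec {c : ℝ} (hc : (c : EReal) < cMin (subGram X Finset.univ))
    (u : EuclideanSpace ℝ (Fin p)) :
    c * ‖u‖ ≤ ‖(WithLp.toLp 2 ((gram X).mulVec u.ofLp) : EuclideanSpace ℝ (Fin p))‖ := by
  by_cases hu : u = 0
  · simp [hu]
  have hu0 : 0 < ‖u‖ := norm_pos_iff.2 hu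
  set w : EuclideanSpace ℝ (Finset.univ : Finset (Fin p)) :=
    WithLp.toLp 2 fun j => ‖u‖⁻¹ * u j with hw
  have hnorm : ∀ f : Fin p → ℝ,
      ‖(WithLp.toLp 2 fun j : (Finset.univ : Finset (Fin p)) => ‖u‖⁻¹ * f j :
        EuclideanSpace ℝ (Finset.univ : Finset (Fin p)))‖ =
      ‖u‖⁻¹ * ‖(WithLp.toLp 2 f : EuclideanSpace ℝ (Fin p))‖ := by
    intro f
    rw [← sq_eq_sq₀ (norm_nonneg _) (by positivity), mul_pow, EuclideanSpace.real_norm_sq_eq,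
      EuclideanSpace.real_norm_sq_eq, Finset.mul_sum]
    simp only [mul_pow]
    exact Finset.sum_coe_sort Finset.univ fun j => ‖u‖⁻¹ ^ 2 * f j ^ 2
  have hw1 : ‖w‖ = 1 := by
    rw [hw, hnorm, WithLp.toLp_ofLp, inv_mul_cancel₀ hu0.ne']
  have h1 : (subGram X Finset.univ).mulVec w.ofLp =
      fun j : (Finset.univ : Finset (Fin p)) => ‖u‖⁻¹ * (gram X).mulVec u.ofLp j := by
    funext j
    simp only [Matrix.mulVec, dotProduct]
    rw [Finset.mul_sum]
    refine Eq.trans (Finset.sum_congr rfl fun l _ => ?_)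
      (Finset.sum_coe_sort Finset.univ fun l => ‖u‖⁻¹ * (gram X j l * u l))
    simp only [subGram, gram, subDesign, hw, Matrix.smul_apply, Matrix.mul_apply,
      Matrix.transpose_apply, Matrix.submatrix_apply, id, smul_eq_mul]
    ring
  have h2 := hc.trans_le (iInf₂_le w hw1)
  rw [h1, hnorm, EReal.coe_lt_coe_iff] at h2
  have h3 := mul_le_mul_of_nonneg_right h2.le hu0.le
  rwa [mul_comm ‖u‖⁻¹, mul_assoc, inv_mul_cancel₀ hu0.ne', mul_one] at h3

end Design

/-! ### Strong convexity, and the minimizer as a function of the response. -/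

section Convexity

variable {X : Matrix (Fin n) (Fin p) ℝ} {ρ : ℝ → ℝ} {lam : ℝ}

/-- The quantitative content of the sparse convexity condition of full rank. -/
theorem SparseConvex.exists_bounds (h : SparseConvex X ρ p) :
    ∃ k c : ℝ, k < c ∧
      (∀ t₁ t₂ : ℝ, 0 < t₁ → t₁ < t₂ → deriv ρ t₁ - deriv ρ t₂ ≤ k * (t₂ - t₁)) ∧
      ∀ b : EuclideanSpace ℝ (Fin p), c * ‖b‖ ^ 2 ≤ (gram X).mulVec b.ofLp ⬝ᵥ b.ofLp := by
  have h1 : maxConcavity ρ < cMin (subGram X Finset.univ) :=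
    lt_of_lt_of_le h (iInf₂_le Finset.univ (by simp))
  -- Real numbers are interposed because `cMin` of an empty matrix is `⊤`.
  obtain ⟨k, hk, hk'⟩ := EReal.lt_iff_exists_real_btwn.1 h1
  obtain ⟨c, hc, hc'⟩ := EReal.lt_iff_exists_real_btwn.1 hk'
  refine ⟨k, c, EReal.coe_lt_coe_iff.1 hc, fun t₁ t₂ h₁ h₂ => ?_,
    mul_norm_sq_le_gram X (mul_norm_le_norm_gram_mulVec X hc')⟩
  have h2 : (((deriv ρ t₁ - deriv ρ t₂) / (t₂ - t₁) : ℝ) : EReal) ≤ k :=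
    le_trans (le_iSup₂_of_le t₁ t₂ (le_iSup₂ (α := EReal) (f := fun (_ : 0 < t₁) (_ : t₁ < t₂) =>
      (((deriv ρ t₁ - deriv ρ t₂) / (t₂ - t₁) : ℝ) : EReal)) h₁ h₂)) hk.le
  rw [EReal.coe_le_coe_iff, div_le_iff₀ (sub_pos.2 h₂)] at h2
  exact h2

/-- The symmetrized penalty becomes convex after adding the concavity bound times `t² / 2`. -/
theorem IsPenalty.convexOn_add_sq (hρ : IsPenalty ρ lam) (hlam : 0 < lam) {k : ℝ}
    (hk : ∀ t₁ t₂ : ℝ, 0 < t₁ → t₁ < t₂ → deriv ρ t₁ - deriv ρ t₂ ≤ k * (t₂ - t₁)) :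
    ConvexOn ℝ univ fun t : ℝ => ρ |t| + k / 2 * t ^ 2 := by
  set g : ℝ → ℝ := fun t => ρ t + k / 2 * t ^ 2 with hg
  have hint : interior (Ici (0 : ℝ)) = Ioi 0 := interior_Ici
  have hder : ∀ t, 0 < t → HasDerivAt g (deriv ρ t + k * t) t := by
    intro t ht
    have h1 := (hρ.differentiableOn.differentiableAt (Ioi_mem_nhds ht)).hasDerivAt
    refine (h1.add (((hasDerivAt_id t).pow 2).const_mul (k / 2))).congr_deriv ?_
    simp
    ring
  have hcont : ContinuousOn g (Ici 0) := hρ.continuousOn.add (by fun_prop)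
  have hmono : ∀ s t, 0 < s → s ≤ t → deriv ρ s + k * s ≤ deriv ρ t + k * t := by
    intro s t hs hst
    rcases hst.eq_or_lt with rfl | hst
    · rfl
    · linarith [hk s t hs hst]
  -- The derivative of `g` increases from the limit `lam` at `0+`, so `g` is nondecreasing. This is
  -- what lets convexity survive composition with the absolute value.
  have hnonneg : ∀ t, 0 < t → 0 ≤ deriv ρ t + k * t := by
    intro t ht
    have hlim : Tendsto (fun s => deriv ρ s + k * s) (𝓝[>] 0) (𝓝 (lam + k * 0)) :=
      hρ.tendsto_deriv.add ((continuous_const_mul k).tendsto 0 |>.mono_left nhdsWithin_le_nhds)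
    have hle : lam + k * 0 ≤ deriv ρ t + k * t := by
      refine le_of_tendsto hlim ?_
      filter_upwards [Ioo_mem_nhdsGT ht] with s hs
      exact hmono s t hs.1 hs.2.le
    linarith
  have hdiff : DifferentiableOn ℝ g (interior (Ici 0)) := by
    rw [hint]
    exact fun t ht => (hder t ht).differentiableAt.differentiableWithinAt
  have hgc : ConvexOn ℝ (Ici 0) g := by
    refine MonotoneOn.convexOn_of_deriv (convex_Ici 0) hcont hdiff ?_
    rw [hint]
    intro s hs t ht hst
    rw [(hder s hs).deriv, (hder t ht).deriv]
    exact hmono s t hs hst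
  have hgm : MonotoneOn g (Ici 0) := by
    refine monotoneOn_of_deriv_nonneg (convex_Ici 0) hcont hdiff fun t ht => ?_
    rw [hint] at ht
    rw [(hder t ht).deriv]
    exact hnonneg t ht
  refine ⟨convex_univ, fun x _ y _ a b ha hb hab => ?_⟩
  have habs : |a • x + b • y| ≤ a • |x| + b • |y| := by
    refine (abs_add_le _ _).trans (le_of_eq ?_)
    rw [smul_eq_mul, smul_eq_mul, abs_mul, abs_mul, abs_of_nonneg ha, abs_of_nonneg hb]
    rfl
  have h1 := hgm (abs_nonneg (a • x + b • y)) ((abs_nonneg _).trans habs) habs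
  have h2 := h1.trans (hgc.2 (abs_nonneg x) (abs_nonneg y) ha hb hab)
  simpa only [hg, sq_abs] using h2

theorem convexComb_norm_sq {F : Type*} [NormedAddCommGroup F] [InnerProductSpace ℝ F] (x y : F)
    {a b : ℝ} (hab : a + b = 1) :
    ‖a • x + b • y‖ ^ 2 = a * ‖x‖ ^ 2 + b * ‖y‖ ^ 2 - a * b * ‖x - y‖ ^ 2 := by
  obtain rfl : b = 1 - a := by linarith
  rw [norm_add_sq_real, norm_sub_sq_real, norm_smul, norm_smul, inner_smul_left, inner_smul_right,
    mul_pow, mul_pow, Real.norm_eq_abs, Real.norm_eq_abs, sq_abs, sq_abs]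
  simp only [conj_trivial]
  ring

/-- Strong convexity of the penalized loss. -/
theorem penLoss_convexComb_le (hρ : IsPenalty ρ lam) (hlam : 0 < lam) {k c : ℝ}
    (hk : ∀ t₁ t₂ : ℝ, 0 < t₁ → t₁ < t₂ → deriv ρ t₁ - deriv ρ t₂ ≤ k * (t₂ - t₁))
    (hc : ∀ b : EuclideanSpace ℝ (Fin p), c * ‖b‖ ^ 2 ≤ (gram X).mulVec b.ofLp ⬝ᵥ b.ofLp)
    (v : EuclideanSpace ℝ (Fin n)) (x y : EuclideanSpace ℝ (Fin p)) {a b : ℝ} (ha : 0 ≤ a)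
    (hb : 0 ≤ b) (hab : a + b = 1) :
    penLoss X ρ v (a • x + b • y) ≤ a * penLoss X ρ v x + b * penLoss X ρ v y -
      a * b * ((c - k) / 2) * ‖x - y‖ ^ 2 := by
  have h1 : v - fit X (a • x + b • y) = a • (v - fit X x) + b • (v - fit X y) := by
    simp only [← fitL_apply, map_add, map_smul]
    calc v - (a • fitL X x + b • fitL X y)
        = (a + b) • v - (a • fitL X x + b • fitL X y) := by rw [hab, one_smul]
      _ = _ := by rw [add_smul, smul_sub, smul_sub]; abel
  have h2 := convexComb_norm_sq (v - fit X x) (v - fit X y) hab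
  rw [← h1] at h2
  have h3 : (v - fit X x) - (v - fit X y) = -fit X (x - y) := by
    simp only [← fitL_apply, map_sub]; abel
  rw [h3, norm_neg] at h2
  have h4 := (hc (x - y)).trans_eq (norm_fit_sq X (x - y)).symm
  -- The penalty lacks at most `k/2` of convexity in each coordinate, while the squared loss
  -- supplies `c/2` by `h4`.
  have h5 : ∀ j, ρ |(a • x + b • y) j| ≤ a * ρ |x j| + b * ρ |y j| +
      a * b * (k / 2) * ((x - y) j) ^ 2 := by
    intro j
    have h6 := (hρ.convexOn_add_sq hlam hk).2 (mem_univ (x j)) (mem_univ (y j)) ha hb hab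
    simp only [smul_eq_mul] at h6
    obtain rfl : b = 1 - a := by linarith
    simp only [PiLp.add_apply, PiLp.smul_apply, PiLp.sub_apply, smul_eq_mul]
    linear_combination h6
  have h7 := Finset.sum_le_sum fun j (_ : j ∈ Finset.univ) => h5 j
  rw [Finset.sum_add_distrib, Finset.sum_add_distrib, ← Finset.mul_sum, ← Finset.mul_sum,
    ← Finset.mul_sum, ← EuclideanSpace.real_norm_sq_eq] at h7
  simp only [penLoss]
  rw [h2, mul_inv]
  have hab0 : 0 ≤ a * b / 2 := by positivity
  have h8 := mul_le_mul_of_nonneg_left h4 hab0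
  linear_combination h7 + h8

theorem IsPenalty.continuous_penLoss (hρ : IsPenalty ρ lam) (v : EuclideanSpace ℝ (Fin n)) :
    Continuous (penLoss X ρ v) := by
  unfold penLoss
  refine (continuous_const.mul ?_).add (continuous_finsetSum _ fun j _ => ?_)
  · exact ((continuous_const.sub (fitL X).continuous).norm.pow 2)
  · exact hρ.continuousOn.comp_continuous (by fun_prop) fun b => abs_nonneg (b j)

theorem fit_injective (hX : IsUnit (gram X).det) : Function.Injective (fit X) := by
  rw [show fit X = fitL X from rfl, injective_iff_map_eq_zero]
  intro b hb
  have h1 : (gram X).mulVec b.ofLp = 0 := by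
    rw [gram, Matrix.smul_mulVec, ← Matrix.mulVec_mulVec]
    have : X.mulVec b.ofLp = 0 := congrArg WithLp.ofLp hb
    rw [this, Matrix.mulVec_zero, smul_zero]
  have h2 : b.ofLp = 0 := by
    have h3 := congrArg ((gram X)⁻¹.mulVec ·) h1
    simpa [Matrix.mulVec_mulVec, Matrix.nonsing_inv_mul _ hX] using h3
  exact (WithLp.ofLp_eq_zero 2).1 h2

/-- For `n = 0` the factor `(2n)⁻¹` is `0` and the loss is not coercive; this disposes of that case.
-/
theorem eq_zero_of_isUnit_det_gram (hX : IsUnit (gram X).det) (hn : n = 0) : p = 0 := by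
  by_contra hp
  have h0 : gram X = 0 := by simp [gram, hn]
  have : Nonempty (Fin p) := ⟨⟨0, Nat.pos_of_ne_zero hp⟩⟩
  rw [h0, Matrix.det_zero] at hX
  simp at hX

/-- A minimizer of the penalized loss exists. -/
theorem exists_isPenLSE (hρ : IsPenalty ρ lam) (hX : IsUnit (gram X).det)
    (v : EuclideanSpace ℝ (Fin n)) : ∃ b, IsPenLSE X ρ v b := by
  rcases Nat.eq_zero_or_pos n with hn | hn
  · have hp := eq_zero_of_isUnit_det_gram hX hn
    subst hp
    exact ⟨0, fun b => by rw [Subsingleton.elim b 0]⟩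
  refine (hρ.continuous_penLoss v).exists_forall_le ?_
  obtain ⟨K, -, hK⟩ := LinearMap.exists_antilipschitzWith
    (fitL X : EuclideanSpace ℝ (Fin p) →ₗ[ℝ] EuclideanSpace ℝ (Fin n))
    (LinearMap.ker_eq_bot.2 (fit_injective hX))
  have h1 : Tendsto (fun b => ‖fit X b - v‖) (cocompact _) atTop := by
    rw [← Metric.cobounded_eq_cocompact]
    have h2 : Tendsto (fun b => ‖fit X b‖) (Bornology.cobounded _) atTop :=
      tendsto_norm_atTop_iff_cobounded.2 hK.tendsto_cobounded
    refine tendsto_atTop_mono (fun b => ?_) (tendsto_atTop_add_const_right _ (-‖v‖) h2)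
    have := norm_sub_norm_le (fit X b) v
    linarith
  have h3 : Tendsto (fun b => (2 * (n : ℝ))⁻¹ * ‖fit X b - v‖ ^ 2 + ∑ _j : Fin p, ρ 0)
      (cocompact _) atTop := by
    refine tendsto_atTop_add_const_right _ _ (Tendsto.const_mul_atTop (by positivity) ?_)
    exact (tendsto_pow_atTop two_ne_zero).comp h1
  refine tendsto_atTop_mono (fun b => ?_) h3
  rw [penLoss, norm_sub_rev]
  gcongr with j
  exact hρ.monotoneOn self_mem_Ici (abs_nonneg (b j)) (abs_nonneg (b j))

/-- The penalized loss grows quadratically away from its minimizer. -/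
theorem IsPenLSE.growth (hρ : IsPenalty ρ lam) (hlam : 0 < lam) {k c : ℝ}
    (hk : ∀ t₁ t₂ : ℝ, 0 < t₁ → t₁ < t₂ → deriv ρ t₁ - deriv ρ t₂ ≤ k * (t₂ - t₁))
    (hc : ∀ b : EuclideanSpace ℝ (Fin p), c * ‖b‖ ^ 2 ≤ (gram X).mulVec b.ofLp ⬝ᵥ b.ofLp)
    {v : EuclideanSpace ℝ (Fin n)} {x : EuclideanSpace ℝ (Fin p)} (hx : IsPenLSE X ρ v x)
    (y : EuclideanSpace ℝ (Fin p)) :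
    penLoss X ρ v x + (c - k) / 2 * ‖x - y‖ ^ 2 ≤ penLoss X ρ v y := by
  -- Minimality of `x` against the point at fraction `b` of the way to `y`, divided by `b`; then `b
  -- → 0`.
  have h1 : ∀ b ∈ Ioo (0 : ℝ) 1, penLoss X ρ v x + (1 - b) * ((c - k) / 2 * ‖x - y‖ ^ 2) ≤
      penLoss X ρ v y := by
    intro b hb
    have h2 := penLoss_convexComb_le (X := X) hρ hlam hk hc v x y (a := 1 - b) (b := b)
      (by linarith [hb.2]) hb.1.le (by ring)
    have h3 := (hx _).trans h2
    have h4 : 0 ≤ b * (penLoss X ρ v y - penLoss X ρ v x -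
        (1 - b) * ((c - k) / 2 * ‖x - y‖ ^ 2)) := by linarith
    have h5 := nonneg_of_mul_nonneg_right h4 hb.1
    linarith
  have h6 : Tendsto (fun b : ℝ => penLoss X ρ v x + (1 - b) * ((c - k) / 2 * ‖x - y‖ ^ 2))
      (𝓝[>] 0) (𝓝 (penLoss X ρ v x + (1 - 0) * ((c - k) / 2 * ‖x - y‖ ^ 2))) :=
    Continuous.tendsto (by fun_prop) 0 |>.mono_left nhdsWithin_le_nhds
  rw [sub_zero, one_mul] at h6
  refine le_of_tendsto h6 ?_
  filter_upwards [Ioo_mem_nhdsGT one_pos] with b hb using h1 b hb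

/-- The penalty and the quadratic term in `x` cancel, leaving an affine function of `x`. Adding the
growth bounds at two minimizers then yields strong monotonicity. -/
theorem penLoss_sub_penLoss (v w : EuclideanSpace ℝ (Fin n)) (x : EuclideanSpace ℝ (Fin p)) :
    penLoss X ρ v x - penLoss X ρ w x =
      (2 * (n : ℝ))⁻¹ * (‖v‖ ^ 2 - ‖w‖ ^ 2) - (n : ℝ)⁻¹ * ⟪v - w, fit X x⟫ := by
  simp only [penLoss]
  rw [norm_sub_sq_real, norm_sub_sq_real, inner_sub_left, mul_inv]
  ring

/-- Strong monotonicity of the penalized estimator in the response vector. -/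
theorem IsPenLSE.mul_norm_sub_sq_le (hρ : IsPenalty ρ lam) (hlam : 0 < lam) {k c : ℝ}
    (hk : ∀ t₁ t₂ : ℝ, 0 < t₁ → t₁ < t₂ → deriv ρ t₁ - deriv ρ t₂ ≤ k * (t₂ - t₁))
    (hc : ∀ b : EuclideanSpace ℝ (Fin p), c * ‖b‖ ^ 2 ≤ (gram X).mulVec b.ofLp ⬝ᵥ b.ofLp)
    {v w : EuclideanSpace ℝ (Fin n)} {x y : EuclideanSpace ℝ (Fin p)} (hx : IsPenLSE X ρ v x)
    (hy : IsPenLSE X ρ w y) :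
    (c - k) * ‖x - y‖ ^ 2 ≤ (n : ℝ)⁻¹ * ⟪v - w, fit X (x - y)⟫ := by
  have h1 := hx.growth hρ hlam hk hc y
  have h2 := hy.growth hρ hlam hk hc x
  rw [norm_sub_rev y x] at h2
  have h3 := penLoss_sub_penLoss (X := X) (ρ := ρ) v w x
  have h4 := penLoss_sub_penLoss (X := X) (ρ := ρ) v w y
  rw [← fitL_apply, map_sub, inner_sub_right, fitL_apply, fitL_apply]
  linear_combination h1 + h2 - h3 + h4

theorem existsUnique_isPenLSE (hρ : IsPenalty ρ lam) (hlam : 0 < lam) (hX : IsUnit (gram X).det)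
    (hconv : SparseConvex X ρ p) (v : EuclideanSpace ℝ (Fin n)) : ∃! b, IsPenLSE X ρ v b := by
  obtain ⟨k, c, hkc, hk, hc⟩ := hconv.exists_bounds
  obtain ⟨b, hb⟩ := exists_isPenLSE hρ hX v
  refine ⟨b, hb, fun b' hb' => ?_⟩
  have h := hb'.mul_norm_sub_sq_le hρ hlam hk hc hb
  rw [sub_self, inner_zero_left, mul_zero] at h
  have h1 : ‖b' - b‖ ^ 2 ≤ 0 := nonpos_of_mul_nonpos_right h (sub_pos.2 hkc)
  rw [← sub_eq_zero, ← norm_eq_zero]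
  exact pow_eq_zero_iff two_ne_zero |>.1 (le_antisymm h1 (sq_nonneg _))

theorem lipschitzWith_of_isPenLSE (hρ : IsPenalty ρ lam) (hlam : 0 < lam) {k c : ℝ} (hkc : k < c)
    (hk : ∀ t₁ t₂ : ℝ, 0 < t₁ → t₁ < t₂ → deriv ρ t₁ - deriv ρ t₂ ≤ k * (t₂ - t₁))
    (hc : ∀ b : EuclideanSpace ℝ (Fin p), c * ‖b‖ ^ 2 ≤ (gram X).mulVec b.ofLp ⬝ᵥ b.ofLp)
    {βh : EuclideanSpace ℝ (Fin n) → EuclideanSpace ℝ (Fin p)}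
    (hβ : ∀ v, IsPenLSE X ρ v (βh v)) : ∃ C, LipschitzWith C βh := by
  have hμ : 0 < c - k := sub_pos.2 hkc
  have key : ∀ v w, ‖βh v - βh w‖ ≤ ((c - k)⁻¹ * ((n : ℝ)⁻¹ * ‖fitL X‖)) * ‖v - w‖ := by
    intro v w
    have h1 := (hβ v).mul_norm_sub_sq_le hρ hlam hk hc (hβ w)
    have h0 : ‖fit X (βh v - βh w)‖ ≤ ‖fitL X‖ * ‖βh v - βh w‖ := norm_fit_le X _
    have h2 : ⟪v - w, fit X (βh v - βh w)⟫ ≤ ‖v - w‖ * (‖fitL X‖ * ‖βh v - βh w‖) :=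
      (real_inner_le_norm _ _).trans (mul_le_mul_of_nonneg_left h0 (norm_nonneg _))
    have hn : 0 ≤ (n : ℝ)⁻¹ := by positivity
    have h3 : (c - k) * ‖βh v - βh w‖ ^ 2 ≤
        (n : ℝ)⁻¹ * (‖v - w‖ * (‖fitL X‖ * ‖βh v - βh w‖)) :=
      h1.trans (mul_le_mul_of_nonneg_left h2 hn)
    rw [mul_assoc, inv_mul_eq_div, le_div_iff₀ hμ]
    rcases (norm_nonneg (βh v - βh w)).eq_or_lt with h0 | h0
    · rw [← h0, zero_mul]; positivity
    · refine le_of_mul_le_mul_right ?_ h0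
      linear_combination h3
  have hC : 0 ≤ (c - k)⁻¹ * ((n : ℝ)⁻¹ * ‖fitL X‖) := by positivity
  refine ⟨⟨_, hC⟩, LipschitzWith.of_dist_le_mul fun v w => ?_⟩
  rw [dist_eq_norm, dist_eq_norm]
  exact key v w

/-- The derivative of `t ↦ ρ |t|` away from the origin. -/
noncomputable def signedDeriv (ρ : ℝ → ℝ) (x : ℝ) : ℝ := Real.sign x * deriv ρ |x|

theorem IsPenalty.hasDerivAt_comp_abs (hρ : IsPenalty ρ lam) {x : ℝ} (hx : x ≠ 0) :
    HasDerivAt (fun t => ρ |t|) (signedDeriv ρ x) x := by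
  have h1 := (hρ.differentiableOn.differentiableAt (Ioi_mem_nhds (abs_pos.2 hx))).hasDerivAt
  refine (h1.comp x (hasDerivAt_abs hx)).congr_deriv ?_
  rw [signedDeriv, mul_comm]
  rcases hx.lt_or_gt with h | h
  · simp [Real.sign_of_neg h, h]
  · simp [Real.sign_of_pos h, h]

/-- The first order condition at the nonzero coordinates of the minimizer. -/
theorem IsPenLSE.inner_eq_signedDeriv (hρ : IsPenalty ρ lam) {v : EuclideanSpace ℝ (Fin n)}
    {x : EuclideanSpace ℝ (Fin p)} (hx : IsPenLSE X ρ v x) {j : Fin p} (hj : x j ≠ 0) :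
    (n : ℝ)⁻¹ * ⟪v - fit X x, fit X (EuclideanSpace.single j 1)⟫ = signedDeriv ρ (x j) := by
  set e : EuclideanSpace ℝ (Fin p) := EuclideanSpace.single j 1 with he
  have h1 : HasDerivAt (fun t : ℝ => v - fit X (x + t • e)) (-fit X e) 0 := by
    have h2 : HasDerivAt (fun t : ℝ => x + t • e) e 0 := by
      simpa using ((hasDerivAt_id (0 : ℝ)).smul_const e).const_add x
    exact ((fitL X).hasFDerivAt.comp_hasDerivAt (0 : ℝ) h2).const_sub v
  have h3 : HasDerivAt (fun t : ℝ => ∑ i, ρ |(x + t • e) i|) (signedDeriv ρ (x j)) 0 := by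
    have h4 : ∀ i ∈ Finset.univ, HasDerivAt (fun t : ℝ => ρ |(x + t • e) i|)
        (if i = j then signedDeriv ρ (x j) else 0) 0 := by
      intro i _
      split_ifs with hij
      · subst hij
        have h5 : HasDerivAt (fun t : ℝ => (x + t • e) i) 1 0 := by
          simpa [he] using (hasDerivAt_id (0 : ℝ)).const_add (x i)
        have h6 : HasDerivAt (fun t => ρ |t|) (signedDeriv ρ (x i)) ((x + (0 : ℝ) • e) i) := by
          simpa using hρ.hasDerivAt_comp_abs hj
        exact (h6.comp (0 : ℝ) h5).congr_deriv (mul_one _)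
      · have h5 : (fun t : ℝ => ρ |(x + t • e) i|) = fun _ => ρ |x i| := by
          funext t; simp [he, hij]
        rw [h5]
        exact hasDerivAt_const _ _
    refine (HasDerivAt.fun_sum h4).congr_deriv ?_
    simp
  have h7 : HasDerivAt (fun t : ℝ => penLoss X ρ v (x + t • e))
      ((2 * (n : ℝ))⁻¹ * (2 * ⟪v - fit X (x + (0 : ℝ) • e), -fit X e⟫) + signedDeriv ρ (x j)) 0 :=
    (h1.norm_sq.const_mul _).add h3
  have h8 : IsLocalMin (fun t : ℝ => penLoss X ρ v (x + t • e)) 0 :=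
    Eventually.of_forall fun t => by simpa using hx (x + t • e)
  have h9 := h8.hasDerivAt_eq_zero h7
  rw [zero_smul, add_zero, inner_neg_right, mul_inv] at h9
  linear_combination -h9

end Convexity

end PenLSE

namespace PenLSE

open scoped Matrix RealInnerProductSpace

variable {n p : ℕ}

/-! ### Directions in the response space dual to the columns of the design. -/

section DualDirections

variable (X : Matrix (Fin n) (Fin p) ℝ)

/-- The direction in the response space along which the `k`-th ordinary least squares coefficient
moves at unit speed up to the factor `n`, the other entries of `Xᵀ v` being fixed. -/
noncomputable def dualDir (k : Fin p) : EuclideanSpace ℝ (Fin n) :=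
  fit X (WithLp.toLp 2 ((gram X)⁻¹.mulVec (Pi.single k 1)))

variable {X}

theorem inner_dualDir_fit (hX : IsUnit (gram X).det) (k : Fin p) (b : EuclideanSpace ℝ (Fin p)) :
    (n : ℝ)⁻¹ * ⟪dualDir X k, fit X b⟫ = b k := by
  rw [dualDir, inner_fit_fit, Matrix.mulVec_mulVec, Matrix.mul_nonsing_inv _ hX, Matrix.one_mulVec,
    single_one_dotProduct]

theorem olse_apply (v : EuclideanSpace ℝ (Fin n)) (k : Fin p) :
    olse X v k = (n : ℝ)⁻¹ * ⟪dualDir X k, v⟫ := by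
  rw [real_inner_comm, dualDir, inner_fit, olse]
  change ((gram X)⁻¹.mulVec ((n : ℝ)⁻¹ • Xᵀ.mulVec v.ofLp)) k = _
  rw [Matrix.mulVec_smul, Pi.smul_apply, smul_eq_mul, Matrix.dotProduct_mulVec,
    ← Matrix.mulVec_transpose, inv_gram_transpose, dotProduct_single_one]

theorem inner_dualDir_dualDir (hX : IsUnit (gram X).det) (i k : Fin p) :
    (n : ℝ)⁻¹ * ⟪dualDir X i, dualDir X k⟫ = (gram X)⁻¹ i k := by
  rw [dualDir.eq_1 X k, inner_dualDir_fit hX, Matrix.mulVec_single_one]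
  rfl

theorem olse_fit (hX : IsUnit (gram X).det) (b : EuclideanSpace ℝ (Fin p)) :
    olse X (fit X b) = b := by
  ext k
  rw [olse_apply, inner_dualDir_fit hX]

end DualDirections

/-! ### Differentiability of the estimator and invertibility of `Q`. -/

section Jacobian

variable {X : Matrix (Fin n) (Fin p) ℝ} {ρ ρ₂ : ℝ → ℝ} {lam k c : ℝ}
  {βh : EuclideanSpace ℝ (Fin n) → EuclideanSpace ℝ (Fin p)}

theorem _root_.HasFDerivAt.euclideanSpace_apply {F : Type*} [NormedAddCommGroup F]
    [NormedSpace ℝ F] {ι : Type*} [Fintype ι] {f : F → EuclideanSpace ℝ ι}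
    {f' : F →L[ℝ] EuclideanSpace ℝ ι} {x : F} (h : HasFDerivAt f f' x) (i : ι) :
    HasFDerivAt (fun y => f y i) ((EuclideanSpace.proj i : EuclideanSpace ℝ ι →L[ℝ] ℝ).comp f') x :=
  (EuclideanSpace.proj i : EuclideanSpace ℝ ι →L[ℝ] ℝ).hasFDerivAt.comp x h

theorem fderiv_euclideanSpace_apply {F : Type*} [NormedAddCommGroup F]
    [NormedSpace ℝ F] {ι : Type*} [Fintype ι] {f : F → EuclideanSpace ℝ ι} {x : F}
    (h : DifferentiableAt ℝ f x) (i : ι) (w : F) :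
    fderiv ℝ (fun y => f y i) x w = (fderiv ℝ f x w) i := by
  rw [(h.hasFDerivAt.euclideanSpace_apply i).fderiv]
  rfl

/-- Strong monotonicity of the estimator, infinitesimally. -/
theorem mul_norm_fderiv_sq_le (hρ : IsPenalty ρ lam) (hlam : 0 < lam)
    (hk : ∀ t₁ t₂ : ℝ, 0 < t₁ → t₁ < t₂ → deriv ρ t₁ - deriv ρ t₂ ≤ k * (t₂ - t₁))
    (hc : ∀ b : EuclideanSpace ℝ (Fin p), c * ‖b‖ ^ 2 ≤ (gram X).mulVec b.ofLp ⬝ᵥ b.ofLp)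
    (hβ : ∀ v, IsPenLSE X ρ v (βh v)) {v : EuclideanSpace ℝ (Fin n)}
    (hd : DifferentiableAt ℝ βh v) (w : EuclideanSpace ℝ (Fin n)) :
    (c - k) * ‖fderiv ℝ βh v w‖ ^ 2 ≤ (n : ℝ)⁻¹ * ⟪w, fit X (fderiv ℝ βh v w)⟫ := by
  have h1 : HasDerivAt (fun t : ℝ => βh (v + t • w)) (fderiv ℝ βh v w) 0 := by
    have h2 : HasDerivAt (fun t : ℝ => v + t • w) w 0 := by
      simpa using ((hasDerivAt_id (0 : ℝ)).smul_const w).const_add v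
    have h3 : HasFDerivAt βh (fderiv ℝ βh v) (v + (0 : ℝ) • w) := by simpa using hd.hasFDerivAt
    exact h3.comp_hasDerivAt (0 : ℝ) h2
  have h4 := h1.tendsto_slope_zero
  simp only [zero_add, zero_smul, add_zero] at h4
  have h5 : Tendsto (fun t : ℝ => (c - k) * ‖t⁻¹ • (βh (v + t • w) - βh v)‖ ^ 2) (𝓝[≠] 0)
      (𝓝 ((c - k) * ‖fderiv ℝ βh v w‖ ^ 2)) := (h4.norm.pow 2).const_mul _
  have h6 : Tendsto (fun t : ℝ => (n : ℝ)⁻¹ * ⟪w, fitL X (t⁻¹ • (βh (v + t • w) - βh v))⟫)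
      (𝓝[≠] 0) (𝓝 ((n : ℝ)⁻¹ * ⟪w, fitL X (fderiv ℝ βh v w)⟫)) :=
    (Tendsto.inner tendsto_const_nhds (((fitL X).continuous.tendsto _).comp h4)).const_mul _
  refine le_of_tendsto_of_tendsto h5 h6 ?_
  filter_upwards [self_mem_nhdsWithin] with t ht
  have ht0 : t ≠ 0 := ht
  have h7 := (hβ (v + t • w)).mul_norm_sub_sq_le hρ hlam hk hc (hβ v)
  rw [add_sub_cancel_left, inner_smul_left, conj_trivial] at h7
  have h8 : 0 ≤ (t⁻¹) ^ 2 := sq_nonneg _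
  have h9 := mul_le_mul_of_nonneg_left h7 h8
  rw [norm_smul, mul_pow, Real.norm_eq_abs, sq_abs, map_smul, inner_smul_right, fitL_apply]
  calc _ = t⁻¹ ^ 2 * ((c - k) * ‖βh (v + t • w) - βh v‖ ^ 2) := by ring
    _ ≤ _ := h9
    _ = _ := by field_simp

/-- Along `dualDir X j` the right side of the infinitesimal monotonicity is the `j`-th coordinate of
the derivative itself, so its vanishing kills the whole derivative. -/
theorem fderiv_dualDir_eq_zero (hX : IsUnit (gram X).det)
    (hρ : IsPenalty ρ lam) (hlam : 0 < lam) (hkc : k < c)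
    (hk : ∀ t₁ t₂ : ℝ, 0 < t₁ → t₁ < t₂ → deriv ρ t₁ - deriv ρ t₂ ≤ k * (t₂ - t₁))
    (hc : ∀ b : EuclideanSpace ℝ (Fin p), c * ‖b‖ ^ 2 ≤ (gram X).mulVec b.ofLp ⬝ᵥ b.ofLp)
    (hβ : ∀ v, IsPenLSE X ρ v (βh v)) {v : EuclideanSpace ℝ (Fin n)}
    (hd : DifferentiableAt ℝ βh v) {j : Fin p} (h : (fderiv ℝ βh v (dualDir X j)) j = 0) :
    fderiv ℝ βh v (dualDir X j) = 0 := by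
  have h1 := mul_norm_fderiv_sq_le hρ hlam hk hc hβ hd (dualDir X j)
  rw [inner_dualDir_fit hX, h] at h1
  have h2 := nonpos_of_mul_nonpos_right h1 (sub_pos.2 hkc)
  exact norm_eq_zero.1 (pow_eq_zero_iff two_ne_zero |>.1 (le_antisymm h2 (sq_nonneg _)))

/-- Adding `t • dualDir X j` to `w` leaves the derivative `δ` unchanged but shifts the right side of
the monotonicity inequality by `t δ_j`, for arbitrary `t`. -/
theorem fderiv_apply_eq_zero (hX : IsUnit (gram X).det)
    (hρ : IsPenalty ρ lam) (hlam : 0 < lam)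
    (hk : ∀ t₁ t₂ : ℝ, 0 < t₁ → t₁ < t₂ → deriv ρ t₁ - deriv ρ t₂ ≤ k * (t₂ - t₁))
    (hc : ∀ b : EuclideanSpace ℝ (Fin p), c * ‖b‖ ^ 2 ≤ (gram X).mulVec b.ofLp ⬝ᵥ b.ofLp)
    (hβ : ∀ v, IsPenLSE X ρ v (βh v)) {v : EuclideanSpace ℝ (Fin n)}
    (hd : DifferentiableAt ℝ βh v) {j : Fin p} (h : fderiv ℝ βh v (dualDir X j) = 0)
    (w : EuclideanSpace ℝ (Fin n)) : (fderiv ℝ βh v w) j = 0 := by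
  by_contra h0
  set δ := fderiv ℝ βh v w with hδ
  -- Chosen so that the right side is exactly one below the left.
  set t : ℝ := ((c - k) * ‖δ‖ ^ 2 - (n : ℝ)⁻¹ * ⟪w, fit X δ⟫ - 1) / δ j with ht
  have h1 := mul_norm_fderiv_sq_le hρ hlam hk hc hβ hd (w + t • dualDir X j)
  rw [map_add, map_smul, h, smul_zero, add_zero, ← hδ, inner_add_left, inner_smul_left,
    conj_trivial, mul_add, mul_left_comm, inner_dualDir_fit hX, ht, div_mul_cancel₀ _ h0] at h1
  linarith

/-- `signedDeriv ρ` is the odd extension of `ρ'`, so its derivative is even and carries no sign. -/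
theorem hasDerivAt_signedDeriv {x : ℝ} (hx : x ≠ 0) (h : HasDerivAt (deriv ρ) (ρ₂ |x|) |x|) :
    HasDerivAt (signedDeriv ρ) (ρ₂ |x|) x := by
  rcases hx.lt_or_gt with hx | hx
  · rw [abs_of_neg hx] at h ⊢
    have h1 : HasDerivAt (fun t => -deriv ρ (-t)) (ρ₂ (-x)) x := by
      exact (h.comp x (hasDerivAt_neg x)).neg.congr_deriv (by simp)
    refine h1.congr_of_eventuallyEq ?_
    filter_upwards [Iio_mem_nhds hx] with t ht
    rw [signedDeriv, Real.sign_of_neg ht, abs_of_neg ht, neg_one_mul]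
  · rw [abs_of_pos hx] at h ⊢
    refine h.congr_of_eventuallyEq ?_
    filter_upwards [Ioi_mem_nhds hx] with t ht
    rw [signedDeriv, Real.sign_of_pos ht, abs_of_pos ht, one_mul]

/-- The gradient of the squared loss at the estimator, as a function of the response. -/
theorem hasFDerivAt_score {v : EuclideanSpace ℝ (Fin n)} (hd : DifferentiableAt ℝ βh v)
    (j : Fin p) :
    HasFDerivAt (fun v => (n : ℝ)⁻¹ * ⟪v - fit X (βh v), fit X (EuclideanSpace.single j 1)⟫)
      ((n : ℝ)⁻¹ • (innerSL ℝ (fit X (EuclideanSpace.single j 1))).comp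
        (ContinuousLinearMap.id ℝ _ - (fitL X).comp (fderiv ℝ βh v))) v := by
  have h1 : HasFDerivAt (fun v => v - fitL X (βh v))
      (ContinuousLinearMap.id ℝ _ - (fitL X).comp (fderiv ℝ βh v)) v :=
    (hasFDerivAt_id v).sub ((fitL X).hasFDerivAt.comp v hd.hasFDerivAt)
  have h2 := ((innerSL ℝ (fit X (EuclideanSpace.single j 1))).hasFDerivAt.comp v h1).const_mul
    (n : ℝ)⁻¹
  refine h2.congr_of_eventuallyEq (Eventually.of_forall fun w => ?_)
  simp only [Function.comp_apply, innerSL_apply_apply, fitL_apply]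
  rw [real_inner_comm]

theorem abs_mem_of_mem_symm {N : Set ℝ} {x : ℝ} (h : |x| ∈ N) : x ∈ N ∪ Neg.neg ⁻¹' N := by
  rcases abs_choice x with hx | hx
  · exact Or.inl (hx ▸ h)
  · exact Or.inr (by rw [hx] at h; exact h)

theorem volume_symm_eq_zero {N : Set ℝ} (hN : volume N = 0) :
    volume (N ∪ Neg.neg ⁻¹' N) = 0 := by
  refine measure_union_null hN ?_
  rw [Measure.measure_preimage_neg]
  exact hN

/-- Almost everywhere, the estimator is differentiable, its vanishing coordinates have vanishing
gradient, and `ρ'` is differentiable with derivative `ρ₂` at its nonzero coordinates. -/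
theorem ae_regular (hX : IsUnit (gram X).det)
    (hρ : IsPenalty ρ lam) (hρ₂ : IsAlmostSecondDeriv ρ ρ₂) (hlam : 0 < lam) (hkc : k < c)
    (hk : ∀ t₁ t₂ : ℝ, 0 < t₁ → t₁ < t₂ → deriv ρ t₁ - deriv ρ t₂ ≤ k * (t₂ - t₁))
    (hc : ∀ b : EuclideanSpace ℝ (Fin p), c * ‖b‖ ^ 2 ≤ (gram X).mulVec b.ofLp ⬝ᵥ b.ofLp)
    (hβ : ∀ v, IsPenLSE X ρ v (βh v)) :
    ∀ᵐ v, DifferentiableAt ℝ βh v ∧ ∀ j, (βh v j = 0 → ∀ w, (fderiv ℝ βh v w) j = 0) ∧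
      (βh v j ≠ 0 → HasDerivAt (deriv ρ) (ρ₂ |βh v j|) |βh v j|) := by
  obtain ⟨C, hC⟩ := lipschitzWith_of_isPenLSE hρ hlam hkc hk hc hβ
  have hcoord : ∀ (N : Set ℝ), volume N = 0 → ∀ j, ∀ᵐ v, DifferentiableAt ℝ βh v → βh v j ∈ N →
      fderiv ℝ βh v (dualDir X j) = 0 := by
    intro N hN j
    filter_upwards [ae_fderiv_apply_eq_zero_of_mem_null volume (fun v => βh v j) (dualDir X j) hN]
      with v hv hd hvN
    refine fderiv_dualDir_eq_zero hX hρ hlam hkc hk hc hβ hd ?_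
    rw [← fderiv_euclideanSpace_apply hd]
    exact hv (hd.hasFDerivAt.euclideanSpace_apply j).differentiableAt hvN
  set N : Set ℝ := {t | 0 < t ∧ ¬HasDerivAt (deriv ρ) (ρ₂ t) t} with hN
  have hN0 : volume N = 0 := by
    have h1 := hρ₂.ae_hasDerivAt
    rw [ae_iff] at h1
    refine measure_mono_null (fun t ht => ?_) h1
    exact fun h => ht.2 (h ht.1)
  have hN1 : volume (deriv ρ '' N) = 0 := hρ₂.volume_image_deriv hN0 fun t ht => ht.1
  have hscore := fun j => ae_fderiv_apply_eq_zero_of_mem_null volume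
    (fun v => (n : ℝ)⁻¹ * ⟪v - fit X (βh v), fit X (EuclideanSpace.single j 1)⟫) (dualDir X j)
    (volume_symm_eq_zero hN1)
  filter_upwards [hC.ae_differentiableAt, ae_all_iff.2 (hcoord {0} (by simp)),
    ae_all_iff.2 (hcoord _ (volume_symm_eq_zero hN0)), ae_all_iff.2 hscore] with v hd h1 h2 h3
  refine ⟨hd, fun j => ⟨fun hj w => ?_, fun hj => ?_⟩⟩
  · exact fderiv_apply_eq_zero hX hρ hlam hk hc hβ hd (h1 j hd hj) w
  -- With `|β̂_j| ∈ N` the estimator is stationary along `dualDir X j`, so the score has derivative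
  -- `1` there; its value lies in the null set `± ρ'(N)`, so the derivative is also `0`.
  · by_contra hcon
    have hmem : |βh v j| ∈ N := ⟨abs_pos.2 hj, hcon⟩
    have h4 := h2 j hd (abs_mem_of_mem_symm hmem)
    have hfd := hasFDerivAt_score (X := X) hd j
    have h5 := h3 j hfd.differentiableAt (by
      rw [(hβ v).inner_eq_signedDeriv hρ hj, signedDeriv]
      rcases hj.lt_or_gt with h | h
      · rw [Real.sign_of_neg h, neg_one_mul]
        exact Or.inr (by simpa using mem_image_of_mem (deriv ρ) hmem)
      · rw [Real.sign_of_pos h, one_mul]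
        exact Or.inl (mem_image_of_mem (deriv ρ) hmem))
    rw [hfd.fderiv] at h5
    have h6 : (n : ℝ)⁻¹ * ⟪fit X (EuclideanSpace.single j 1), dualDir X j⟫ = 0 := by
      simpa only [_root_.smul_apply, ContinuousLinearMap.comp_apply,
        _root_.sub_apply, ContinuousLinearMap.id_apply, h4, map_zero, sub_zero,
        innerSL_apply_apply, smul_eq_mul] using h5
    rw [real_inner_comm, inner_dualDir_fit hX] at h6
    simp at h6

/-- The sandwich matrix `P̂ᵀ Q⁻¹ P̂`. -/
noncomputable def sandwich (X : Matrix (Fin n) (Fin p) ℝ) (ρ₂ : ℝ → ℝ)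
    (b : EuclideanSpace ℝ (Fin p)) : Matrix (Fin p) (Fin p) ℝ :=
  (proj b)ᵀ * (Q X ρ₂ b)⁻¹ * proj b

/-- The matrix of derivatives of the estimator along the dual directions. -/
noncomputable def jac (X : Matrix (Fin n) (Fin p) ℝ)
    (βh : EuclideanSpace ℝ (Fin n) → EuclideanSpace ℝ (Fin p)) (v : EuclideanSpace ℝ (Fin n)) :
    Matrix (Fin p) (Fin p) ℝ :=
  Matrix.of fun i k => fderiv ℝ (fun w => βh w i) v (dualDir X k)

theorem mem_support {b : EuclideanSpace ℝ (Fin p)} {j : Fin p} : j ∈ support b ↔ b j ≠ 0 := by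
  simp [support]

theorem proj_mul (b : EuclideanSpace ℝ (Fin p)) {ι : Type*} (M : Matrix (Fin p) ι ℝ) :
    proj b * M = M.submatrix (fun i : support b => (i : Fin p)) id := by
  ext i j
  simp [proj, Matrix.mul_apply]

theorem proj_mul_transpose (b : EuclideanSpace ℝ (Fin p)) : proj b * (proj b)ᵀ = 1 := by
  rw [proj_mul]
  ext i j
  simp only [Matrix.submatrix_apply, Matrix.transpose_apply, proj, Matrix.of_apply, id,
    Matrix.one_apply, Subtype.ext_iff]
  exact if_congr eq_comm rfl rfl

theorem transpose_proj_mul (b : EuclideanSpace ℝ (Fin p)) (M : Matrix (Fin p) (Fin p) ℝ)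
    (hM : ∀ i, b i = 0 → ∀ k, M i k = 0) : (proj b)ᵀ * (proj b * M) = M := by
  rw [proj_mul]
  ext i j
  simp only [Matrix.mul_apply, Matrix.transpose_apply, proj, Matrix.of_apply,
    Matrix.submatrix_apply, id, ite_mul, one_mul, zero_mul]
  rw [Finset.sum_coe_sort (support b) fun x => if x = i then M x j else 0, Finset.sum_ite_eq']
  split_ifs with hi
  · rfl
  · rw [mem_support, not_not] at hi
    exact (hM i hi j).symm

theorem trace_sandwich (b : EuclideanSpace ℝ (Fin p)) :
    (sandwich X ρ₂ b).trace = ((Q X ρ₂ b)⁻¹).trace := by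
  rw [sandwich, Matrix.trace_mul_comm, ← Matrix.mul_assoc, proj_mul_transpose, Matrix.one_mul]

theorem dotProduct_sandwich_mulVec (b : EuclideanSpace ℝ (Fin p)) (a : Fin p → ℝ) :
    ((proj b).mulVec a) ⬝ᵥ ((Q X ρ₂ b)⁻¹.mulVec ((proj b).mulVec a)) =
      a ⬝ᵥ (sandwich X ρ₂ b).mulVec a := by
  rw [sandwich, ← Matrix.mulVec_mulVec, ← Matrix.mulVec_mulVec, Matrix.dotProduct_mulVec a,
    Matrix.vecMul_transpose]

theorem sandwich_transpose (b : EuclideanSpace ℝ (Fin p)) :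
    (sandwich X ρ₂ b)ᵀ = sandwich X ρ₂ b := by
  have hQ : (Q X ρ₂ b)ᵀ = Q X ρ₂ b := by
    rw [Q, Matrix.transpose_add, Matrix.diagonal_transpose, subGram, Matrix.transpose_smul,
      Matrix.transpose_mul, Matrix.transpose_transpose]
  rw [sandwich, Matrix.transpose_mul, Matrix.transpose_mul, Matrix.transpose_transpose,
    Matrix.transpose_nonsing_inv, hQ, Matrix.mul_assoc]

theorem sandwich_apply_comm (b : EuclideanSpace ℝ (Fin p)) (i j : Fin p) :
    sandwich X ρ₂ b i j = sandwich X ρ₂ b j i := by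
  rw [← Matrix.transpose_apply (sandwich X ρ₂ b), sandwich_transpose]

/-- The differentiated first order condition. -/
theorem gram_mul_jac_add (hX : IsUnit (gram X).det) (hρ : IsPenalty ρ lam)
    (hβ : ∀ v, IsPenLSE X ρ v (βh v)) {v : EuclideanSpace ℝ (Fin n)}
    (hd : DifferentiableAt ℝ βh v) {i : Fin p} (hi : βh v i ≠ 0)
    (h2 : HasDerivAt (deriv ρ) (ρ₂ |βh v i|) |βh v i|) (l : Fin p) :
    (gram X * jac X βh v) i l + ρ₂ |βh v i| * jac X βh v i l = if i = l then 1 else 0 := by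
  have h3 := hasFDerivAt_score (X := X) hd i
  have h4 : HasFDerivAt (fun v => signedDeriv ρ (βh v i))
      (ρ₂ |βh v i| • (EuclideanSpace.proj i : EuclideanSpace ℝ (Fin p) →L[ℝ] ℝ).comp
        (fderiv ℝ βh v)) v :=
    HasDerivAt.comp_hasFDerivAt (h₂ := signedDeriv ρ) (f := fun v => βh v i) v
      (hasDerivAt_signedDeriv hi h2) (hd.hasFDerivAt.euclideanSpace_apply i)
  -- The first order condition thus holds as an equality on a neighbourhood and may be
  -- differentiated.
  have h5 : ∀ᶠ w in 𝓝 v, βh w i ≠ 0 :=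
    (hd.hasFDerivAt.euclideanSpace_apply i).continuousAt.eventually_ne hi
  have h6 := h3.unique (h4.congr_of_eventuallyEq (h5.mono fun w hw =>
    (hβ w).inner_eq_signedDeriv hρ hw))
  have h7 := congrArg (fun L => L (dualDir X l)) h6
  set δ := fderiv ℝ βh v (dualDir X l) with hδ
  have h8 : ∀ a, jac X βh v a l = δ a := fun a => fderiv_euclideanSpace_apply hd a _
  have h9 : (n : ℝ)⁻¹ * ⟪fit X (EuclideanSpace.single i 1), dualDir X l - fit X δ⟫ =
      ρ₂ |βh v i| * δ i := by
    simp only [_root_.smul_apply, ContinuousLinearMap.comp_apply, _root_.sub_apply,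
      ContinuousLinearMap.id_apply, fitL_apply, innerSL_apply_apply, smul_eq_mul] at h7
    exact h7
  rw [inner_sub_right, mul_sub, real_inner_comm, inner_dualDir_fit hX, inner_fit_fit] at h9
  have h10 : (gram X).mulVec (EuclideanSpace.single i (1 : ℝ)).ofLp ⬝ᵥ δ.ofLp =
      (gram X * jac X βh v) i l := by
    rw [dotProduct_comm, Matrix.dotProduct_mulVec, ← Matrix.mulVec_transpose, gram_transpose]
    simp only [PiLp.ofLp_single, dotProduct_single_one]
    simp only [Matrix.mulVec, Matrix.mul_apply, dotProduct, h8]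
  rw [h10] at h9
  rw [h8, ← h9]
  simp [eq_comm]

/-- The differentiated first order conditions for the rows in the support. The sum over all columns
of `Σ` reduces to the support because the other rows of the Jacobian vanish. -/
theorem Q_mul_proj_mul_jac (hX : IsUnit (gram X).det) (hρ : IsPenalty ρ lam)
    (hβ : ∀ v, IsPenLSE X ρ v (βh v)) {v : EuclideanSpace ℝ (Fin n)}
    (hd : DifferentiableAt ℝ βh v) (h : ∀ j, (βh v j = 0 → ∀ w, (fderiv ℝ βh v w) j = 0) ∧
      (βh v j ≠ 0 → HasDerivAt (deriv ρ) (ρ₂ |βh v j|) |βh v j|)) :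
    Q X ρ₂ (βh v) * (proj (βh v) * jac X βh v) = proj (βh v) := by
  rw [proj_mul, Q, Matrix.add_mul]
  ext i l
  have hi : βh v i ≠ 0 := mem_support.1 i.2
  rw [Matrix.add_apply, Matrix.diagonal_mul]
  have h1 : (subGram X (support (βh v)) *
      (jac X βh v).submatrix (fun i : support (βh v) => (i : Fin p)) id) i l =
      (gram X * jac X βh v) i l := by
    have h2 : ∀ a b, subGram X (support (βh v)) a b = gram X a b := by
      intro a b
      simp only [subGram, gram, subDesign, Matrix.smul_apply, Matrix.mul_apply,
        Matrix.transpose_apply, Matrix.submatrix_apply, id]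
    simp only [Matrix.mul_apply, h2, Matrix.submatrix_apply, id]
    rw [Finset.sum_coe_sort (support (βh v)) fun a => gram X i a * jac X βh v a l]
    refine Finset.sum_subset (Finset.subset_univ _) fun a _ ha => ?_
    rw [mem_support, not_not] at ha
    rw [show jac X βh v a l = (fderiv ℝ βh v (dualDir X l)) a from
      fderiv_euclideanSpace_apply hd a _, (h a).1 ha, mul_zero]
  rw [h1, Matrix.submatrix_apply, id, gram_mul_jac_add hX hρ hβ hd hi ((h i).2 hi) l]
  rfl

/-- Almost everywhere, `Q` is invertible and `P̂ᵀ Q⁻¹ P̂` is the derivative of the estimator. -/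
theorem ae_isUnit_det_Q_and_sandwich_eq (hX : IsUnit (gram X).det)
    (hρ : IsPenalty ρ lam) (hρ₂ : IsAlmostSecondDeriv ρ ρ₂) (hlam : 0 < lam) (hkc : k < c)
    (hk : ∀ t₁ t₂ : ℝ, 0 < t₁ → t₁ < t₂ → deriv ρ t₁ - deriv ρ t₂ ≤ k * (t₂ - t₁))
    (hc : ∀ b : EuclideanSpace ℝ (Fin p), c * ‖b‖ ^ 2 ≤ (gram X).mulVec b.ofLp ⬝ᵥ b.ofLp)
    (hβ : ∀ v, IsPenLSE X ρ v (βh v)) :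
    ∀ᵐ v, IsUnit (Q X ρ₂ (βh v)).det ∧ sandwich X ρ₂ (βh v) = jac X βh v := by
  filter_upwards [ae_regular hX hρ hρ₂ hlam hkc hk hc hβ] with v hv
  obtain ⟨hd, h⟩ := hv
  have h1 := Q_mul_proj_mul_jac hX hρ hβ hd h
  -- Invertibility comes from an explicit right inverse, the support block of the Jacobian; no
  -- positivity of `Q` is invoked.
  have h2 : Q X ρ₂ (βh v) * (proj (βh v) * jac X βh v * (proj (βh v))ᵀ) = 1 := by
    rw [← Matrix.mul_assoc, h1, proj_mul_transpose]
  have h3 : IsUnit (Q X ρ₂ (βh v)).det := Matrix.isUnit_det_of_right_inverse h2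
  refine ⟨h3, ?_⟩
  have h4 : (Q X ρ₂ (βh v))⁻¹ * proj (βh v) = proj (βh v) * jac X βh v := by
    conv_lhs => rw [← h1]
    rw [← Matrix.mul_assoc, Matrix.nonsing_inv_mul _ h3, Matrix.one_mul]
  rw [sandwich, Matrix.mul_assoc, h4]
  refine transpose_proj_mul _ _ fun i hi l => ?_
  exact (fderiv_euclideanSpace_apply hd i _).trans ((h i).1 hi _)

end Jacobian

end PenLSE

namespace PenLSE

open scoped Matrix RealInnerProductSpace NNReal ENNReal

variable {n p : ℕ}

/-! ### Transfer between the response distribution and the standard Gaussian. -/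

section Response

variable {E : Type*} [NormedAddCommGroup E] [InnerProductSpace ℝ E] [FiniteDimensional ℝ E]
  [MeasurableSpace E] [BorelSpace E]

/-- Comparing characteristic functions also covers the degenerate case `σ = 0`. -/
theorem multivariateGaussian_smul_one (σ : ℝ) :
    multivariateGaussian 0 (σ ^ 2 • (1 : Matrix (Fin n) (Fin n) ℝ)) =
      (stdGaussian (EuclideanSpace ℝ (Fin n))).map (σ • ·) := by
  have hS : (σ ^ 2 • (1 : Matrix (Fin n) (Fin n) ℝ)).PosSemidef :=
    Matrix.PosSemidef.one.smul (sq_nonneg σ)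
  have : IsProbabilityMeasure ((stdGaussian (EuclideanSpace ℝ (Fin n))).map (σ • ·)) :=
    Measure.isProbabilityMeasure_map (by fun_prop)
  refine Measure.ext_of_charFun (funext fun t => ?_)
  rw [charFun_multivariateGaussian hS, charFun_map_smul, charFun_stdGaussian, inner_zero_right,
    Matrix.smul_mulVec, Matrix.one_mulVec, dotProduct_smul, ← inner_eq_dotProduct,
    real_inner_self_eq_norm_sq, norm_smul, ← Complex.ofReal_pow, mul_pow, Real.norm_eq_abs,
    sq_abs]
  simp [neg_div]

/-- An invertible affine map pulls Lebesgue null sets back to null sets, and the Gaussian measure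
has a density. -/
theorem ae_stdGaussian_add_smul {q : E → Prop} (h : ∀ᵐ v, q v) (m : E) {σ : ℝ} (hσ : σ ≠ 0) :
    ∀ᵐ x ∂(stdGaussian E), q (m + σ • x) := by
  refine stdGaussian_absolutelyContinuous.ae_le (show ∀ᵐ x ∂volume, q (m + σ • x) from ?_)
  rw [ae_iff] at h ⊢
  have h1 : {x | ¬q (m + σ • x)} = (σ • ·) ⁻¹' ((m + ·) ⁻¹' {v | ¬q v}) := rfl
  rw [h1, Measure.addHaar_preimage_smul _ hσ, measure_preimage_add, h, mul_zero]

theorem hasLaw_inv_smul {Ω : Type*} [MeasurableSpace Ω] {P : Measure Ω} {σ : ℝ} (hσ : σ ≠ 0)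
    {ε : Ω → E} (hε : HasLaw ε ((stdGaussian E).map (σ • ·)) P) :
    HasLaw (fun ω => σ⁻¹ • ε ω) (stdGaussian E) P := by
  refine ⟨hε.aemeasurable.const_smul _, ?_⟩
  have h1 : (fun ω => σ⁻¹ • ε ω) = (σ⁻¹ • ·) ∘ ε := rfl
  rw [h1, ← AEMeasurable.map_map_of_aemeasurable (by fun_prop) hε.aemeasurable, hε.map_eq,
    Measure.map_map (by fun_prop) (by fun_prop)]
  have h2 : ((σ⁻¹ • ·) ∘ (σ • ·) : E → E) = id := by
    funext x; simp [smul_smul, inv_mul_cancel₀ hσ]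
  rw [h2, Measure.map_id]

/-- Expectations of functions of `m + σ ξ`, `ξ` standard Gaussian. -/
theorem integrable_comp_response {Ω : Type*} [MeasurableSpace Ω] {P : Measure Ω}
    [IsProbabilityMeasure P] {σ : ℝ} {ε : Ω → E} (hε : HasLaw ε ((stdGaussian E).map (σ • ·)) P)
    (m : E) {y : Ω → E} (hy : ∀ ω, y ω = m + ε ω) {G : E → ℝ}
    (hG : Integrable (fun x => G (m + σ • x)) (stdGaussian E)) :
    Integrable (fun ω => G (y ω)) P ∧
      ∫ ω, G (y ω) ∂P = ∫ x, G (m + σ • x) ∂(stdGaussian E) := by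
  simp only [hy]
  -- For `σ = 0` the noise vanishes almost surely and both sides are `G m`; otherwise `σ⁻¹ • ε` is
  -- standard Gaussian.
  by_cases hσ : σ = 0
  · subst hσ
    have h0 : ∀ᵐ ω ∂P, ε ω = 0 := by
      have h1 : ∀ᵐ x ∂((stdGaussian E).map ((0 : ℝ) • ·)), x = 0 := by
        have hs : MeasurableSet {x : E | x = 0} := measurableSet_singleton 0
        rw [ae_map_iff (by fun_prop) hs]
        simp
      rw [← hε.map_eq] at h1
      exact ae_of_ae_map hε.aemeasurable h1
    have h2 : (fun ω => G (m + ε ω)) =ᵐ[P] fun _ => G m := by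
      filter_upwards [h0] with ω hω
      rw [hω, add_zero]
    refine ⟨(integrable_const _).congr h2.symm, ?_⟩
    rw [integral_congr_ae h2]
    simp
  · have hξ := hasLaw_inv_smul hσ hε
    have h3 : (fun ω => G (m + ε ω)) = (fun x => G (m + σ • x)) ∘ fun ω => σ⁻¹ • ε ω := by
      funext ω; simp [smul_smul, mul_inv_cancel₀ hσ]
    rw [h3]
    refine ⟨?_, hξ.integral_comp hG.aestronglyMeasurable⟩
    refine Integrable.comp_aemeasurable ?_ hξ.aemeasurable
    rwa [hξ.map_eq]

end Response

/-! ### The projection onto the column space and the residual. -/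

section HatMatrix

variable (X : Matrix (Fin n) (Fin p) ℝ)

/-- The ordinary least squares estimator as a continuous linear map. -/
noncomputable def olseL : EuclideanSpace ℝ (Fin n) →L[ℝ] EuclideanSpace ℝ (Fin p) :=
  LinearMap.toContinuousLinearMap (Matrix.toLpLin 2 2 ((n : ℝ)⁻¹ • ((gram X)⁻¹ * Xᵀ)))

theorem olseL_apply (v : EuclideanSpace ℝ (Fin n)) : olseL X v = olse X v := by
  change WithLp.toLp 2 (((n : ℝ)⁻¹ • ((gram X)⁻¹ * Xᵀ)).mulVec v.ofLp) = olse X v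
  rw [olse, Matrix.smul_mulVec, ← Matrix.mulVec_mulVec, Matrix.mulVec_smul]

/-- The orthogonal projection onto the column space, as a continuous linear map. -/
noncomputable def hatL : EuclideanSpace ℝ (Fin n) →L[ℝ] EuclideanSpace ℝ (Fin n) :=
  (fitL X).comp (olseL X)

theorem hatL_apply (v : EuclideanSpace ℝ (Fin n)) : hatL X v = fit X (olse X v) := by
  rw [hatL, ContinuousLinearMap.comp_apply, fitL_apply, olseL_apply]

theorem inner_hatL (v w : EuclideanSpace ℝ (Fin n)) :
    ⟪hatL X v, w⟫ = (n : ℝ)⁻¹ * (Xᵀ.mulVec w.ofLp ⬝ᵥ (gram X)⁻¹.mulVec (Xᵀ.mulVec v.ofLp)) := by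
  rw [hatL_apply, real_inner_comm, inner_fit, olse, Matrix.mulVec_smul, dotProduct_smul,
    smul_eq_mul]

theorem inner_hatL_comm (v w : EuclideanSpace ℝ (Fin n)) : ⟪hatL X v, w⟫ = ⟪v, hatL X w⟫ := by
  rw [inner_hatL, real_inner_comm, inner_hatL, Matrix.dotProduct_mulVec,
    ← Matrix.mulVec_transpose, inv_gram_transpose, dotProduct_comm]

variable {X}

theorem hatL_fit (hX : IsUnit (gram X).det) (b : EuclideanSpace ℝ (Fin p)) :
    hatL X (fit X b) = fit X b := by
  rw [hatL_apply, olse_fit hX]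

theorem hatL_hatL (hX : IsUnit (gram X).det) (v : EuclideanSpace ℝ (Fin n)) :
    hatL X (hatL X v) = hatL X v := by
  rw [hatL_apply X v, hatL_fit hX]

/-- By cyclicity, the trace of the hat matrix is that of the `p × p` identity. -/
theorem sum_inner_hatL (hX : IsUnit (gram X).det) :
    ∑ i, ⟪hatL X (EuclideanSpace.single i 1), EuclideanSpace.single i 1⟫ = p := by
  have h1 : ∀ i, ⟪hatL X (EuclideanSpace.single i 1), EuclideanSpace.single i 1⟫ =
      (X * ((n : ℝ)⁻¹ • ((gram X)⁻¹ * Xᵀ))) i i := by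
    intro i
    rw [inner_hatL, PiLp.ofLp_single, Matrix.mulVec_single_one, Matrix.mul_smul, Matrix.smul_apply,
      smul_eq_mul, Matrix.mul_apply]
    congr 1
  have h2 : ((n : ℝ)⁻¹ • ((gram X)⁻¹ * Xᵀ)) * X = 1 := by
    rw [Matrix.smul_mul, Matrix.mul_assoc, ← Matrix.mul_smul, ← gram, Matrix.nonsing_inv_mul _ hX]
  calc _ = (X * ((n : ℝ)⁻¹ • ((gram X)⁻¹ * Xᵀ))).trace :=
        Finset.sum_congr rfl fun i _ => h1 i
    _ = p := by rw [Matrix.trace_mul_comm, h2, Matrix.trace_one, Fintype.card_fin]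

/-- The residual map of the ordinary least squares fit. -/
noncomputable def residL (X : Matrix (Fin n) (Fin p) ℝ) :
    EuclideanSpace ℝ (Fin n) →L[ℝ] EuclideanSpace ℝ (Fin n) :=
  ContinuousLinearMap.id ℝ _ - hatL X

theorem residL_apply (v : EuclideanSpace ℝ (Fin n)) : residL X v = v - fit X (olse X v) := by
  rw [← hatL_apply]; rfl

theorem inner_residL_comm (v w : EuclideanSpace ℝ (Fin n)) :
    ⟪residL X v, w⟫ = ⟪v, residL X w⟫ := by
  rw [residL_apply, residL_apply, ← hatL_apply, ← hatL_apply, inner_sub_left, inner_sub_right,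
    inner_hatL_comm]

theorem residL_fit_add_smul (hX : IsUnit (gram X).det) (b : EuclideanSpace ℝ (Fin p)) (σ : ℝ)
    (v : EuclideanSpace ℝ (Fin n)) : residL X (fit X b + σ • v) = σ • residL X v := by
  rw [map_add, map_smul, residL_apply (fit X b), olse_fit hX, sub_self, zero_add]

theorem integrable_norm_residL_sq :
    Integrable (fun x => ‖residL X x‖ ^ 2) (stdGaussian (EuclideanSpace ℝ (Fin n))) :=
  ((memLp_two_of_lipschitzWith (residL X).lipschitz).integrable_norm_pow two_ne_zero)

/-- The mean is `∑ ‖R e_i‖²` for the residual projection `R`, that is, its trace; hence the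
normalization `n - p`. -/
theorem integral_norm_residL_sq (hX : IsUnit (gram X).det) :
    ∫ x, ‖residL X x‖ ^ 2 ∂(stdGaussian (EuclideanSpace ℝ (Fin n))) = (n : ℝ) - p := by
  have h1 : ∀ x, ‖residL X x‖ ^ 2 = ∑ i, ⟪residL X (EuclideanSpace.single i 1), x⟫ *
      ⟪residL X (EuclideanSpace.single i 1), x⟫ := by
    intro x
    rw [EuclideanSpace.real_norm_sq_eq]
    refine Finset.sum_congr rfl fun i _ => ?_
    rw [inner_residL_comm, ← sq]
    congr 1
    rw [inner_eq_dotProduct, PiLp.ofLp_single, single_one_dotProduct]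
  simp only [h1]
  rw [integral_finsetSum]
  · simp only [integral_inner_mul_inner_stdGaussian]
    have h2 : ∀ i, ⟪residL X (EuclideanSpace.single i 1), residL X (EuclideanSpace.single i 1)⟫ =
        1 - ⟪hatL X (EuclideanSpace.single i 1), EuclideanSpace.single i 1⟫ := by
      intro i
      rw [inner_residL_comm, residL_apply (residL X _), residL_apply, ← hatL_apply, ← hatL_apply,
        map_sub, hatL_hatL hX, sub_self, sub_zero, inner_sub_right, real_inner_self_eq_norm_sq,
        ← inner_hatL_comm]
      simp
    simp only [h2, Finset.sum_sub_distrib, sum_inner_hatL hX]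
    simp
  · intro i _
    have h3 := memLp_two_of_lipschitzWith
      (innerSL ℝ (residL X (EuclideanSpace.single i (1 : ℝ)))).lipschitz
    exact h3.integrable_mul h3

end HatMatrix

/-! ### Dependence on the projected response, and Stein's identity for the estimator. -/

section Jacobian

variable {X : Matrix (Fin n) (Fin p) ℝ} {ρ ρ₂ : ℝ → ℝ} {lam k c : ℝ}
  {βh : EuclideanSpace ℝ (Fin n) → EuclideanSpace ℝ (Fin p)}

/-- The residual is orthogonal to the column space, so replacing `v` by its projection changes the
loss by a constant and keeps the minimizer. -/
theorem penLoss_hatL (hX : IsUnit (gram X).det) (v : EuclideanSpace ℝ (Fin n))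
    (b : EuclideanSpace ℝ (Fin p)) :
    penLoss X ρ v b = penLoss X ρ (hatL X v) b +
      (2 * (n : ℝ))⁻¹ * (‖v‖ ^ 2 - ‖hatL X v‖ ^ 2) := by
  have h := penLoss_sub_penLoss (X := X) (ρ := ρ) v (hatL X v) b
  have h1 : ⟪v - hatL X v, fit X b⟫ = 0 := by
    rw [inner_sub_left, inner_hatL_comm, hatL_fit hX, sub_self]
  rw [h1] at h
  linarith

theorem apply_hatL_eq (hX : IsUnit (gram X).det)
    (hu : ∀ v : EuclideanSpace ℝ (Fin n), ∃! b : EuclideanSpace ℝ (Fin p), IsPenLSE X ρ v b)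
    (hβ : ∀ v, IsPenLSE X ρ v (βh v)) (v : EuclideanSpace ℝ (Fin n)) : βh (hatL X v) = βh v := by
  refine (hu v).unique (fun b => ?_) (hβ v)
  rw [penLoss_hatL hX, penLoss_hatL hX v b]
  exact add_le_add_left (hβ (hatL X v) b) _

/-- The estimator agrees near `v` and near its projection after translation, so no differentiability
is needed. -/
theorem jac_hatL (hX : IsUnit (gram X).det)
    (hu : ∀ v : EuclideanSpace ℝ (Fin n), ∃! b : EuclideanSpace ℝ (Fin p), IsPenLSE X ρ v b)
    (hβ : ∀ v, IsPenLSE X ρ v (βh v)) (v : EuclideanSpace ℝ (Fin n)) :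
    jac X βh (hatL X v) = jac X βh v := by
  have h1 : ∀ w, βh (hatL X v + w) = βh (v + w) := by
    intro w
    rw [← apply_hatL_eq hX hu hβ (v + w), ← apply_hatL_eq hX hu hβ (hatL X v + w), map_add, map_add,
      hatL_hatL hX]
  ext i l
  simp only [jac, Matrix.of_apply]
  have h2 : ∀ v, fderiv ℝ (fun w => βh w i) v = fderiv ℝ (fun w => βh (v + w) i) 0 := by
    intro v
    rw [fderiv_comp_add_left v (f := fun w => βh w i), add_zero]
  rw [h2, h2 v]
  simp only [h1]

theorem lipschitzWith_euclideanSpace_apply {F : Type*} [PseudoEMetricSpace F] {ι : Type*}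
    [Fintype ι] {f : F → EuclideanSpace ℝ ι} {C : ℝ≥0} (h : LipschitzWith C f) (i : ι) :
    LipschitzWith C fun x => f x i := by
  have h1 : LipschitzWith 1 fun x : EuclideanSpace ℝ ι => x i :=
    LipschitzWith.of_dist_le_mul fun x y => by
      rw [NNReal.coe_one, one_mul, dist_eq_norm, dist_eq_norm]
      exact PiLp.norm_apply_le (x - y) i
  have h2 := h1.comp h
  rwa [one_mul] at h2

theorem abs_jac_le {C : ℝ≥0} (hC : LipschitzWith C βh) (v : EuclideanSpace ℝ (Fin n))
    (i l : Fin p) : |jac X βh v i l| ≤ C * ‖dualDir X l‖ := by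
  rw [← Real.norm_eq_abs]
  exact (ContinuousLinearMap.le_opNorm _ _).trans (mul_le_mul_of_nonneg_right
    (norm_fderiv_le_of_lipschitz ℝ (lipschitzWith_euclideanSpace_apply hC i)) (norm_nonneg _))

theorem measurable_jac (i l : Fin p) : Measurable fun v => jac X βh v i l :=
  measurable_fderiv_apply_const ℝ (fun w => βh w i) (dualDir X l)

theorem integrable_jac {C : ℝ≥0} (hC : LipschitzWith C βh) (m : EuclideanSpace ℝ (Fin n)) (σ : ℝ)
    (i l : Fin p) :
    Integrable (fun x => jac X βh (m + σ • x) i l) (stdGaussian (EuclideanSpace ℝ (Fin n))) :=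
  Integrable.of_bound ((measurable_jac i l).comp (by fun_prop)).aestronglyMeasurable _
    (ae_of_all _ fun x => abs_jac_le hC _ i l)

/-- Stein's identity for the coordinates of the estimator. -/
theorem integral_mul_inner_dualDir {C : ℝ≥0} (hC : LipschitzWith C βh)
    (m : EuclideanSpace ℝ (Fin n)) (σ b : ℝ) (i l : Fin p) :
    ∫ x, (βh (m + σ • x) i - b) * ⟪dualDir X l, x⟫ ∂(stdGaussian (EuclideanSpace ℝ (Fin n))) =
      σ * ∫ x, jac X βh (m + σ • x) i l ∂(stdGaussian (EuclideanSpace ℝ (Fin n))) := by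
  have h1 : LipschitzWith (C * ‖σ‖₊) fun x => βh (m + σ • x) i - b := by
    have h2 : LipschitzWith ‖σ‖₊ fun x : EuclideanSpace ℝ (Fin n) => m + σ • x :=
      LipschitzWith.of_dist_le_mul fun x y => by
        rw [dist_add_left, dist_smul₀, coe_nnnorm]
    have h3 := (lipschitzWith_euclideanSpace_apply hC i).comp h2
    refine LipschitzWith.of_dist_le_mul fun x y => ?_
    rw [dist_sub_right]
    exact h3.dist_le_mul x y
  rw [integral_mul_inner_stdGaussian h1, ← integral_const_mul]
  congr 1 with x
  rw [fderiv_sub_const, fderiv_comp_smul (f := fun x => βh (m + x) i),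
    fderiv_comp_add_left m (f := fun x => βh x i)]
  rfl

end Jacobian

end PenLSE

namespace PenLSE

open scoped Matrix RealInnerProductSpace NNReal ENNReal

variable {n p : ℕ} {X : Matrix (Fin n) (Fin p) ℝ} {ρ ρ₂ : ℝ → ℝ} {lam k c : ℝ}
  {βh : EuclideanSpace ℝ (Fin n) → EuclideanSpace ℝ (Fin p)}

/-! ### Second moments of the estimation error. -/

section Moments

theorem memLp_two_coord {C : ℝ≥0} (hC : LipschitzWith C βh) (m : EuclideanSpace ℝ (Fin n))
    (σ b : ℝ) (i : Fin p) :
    MemLp (fun x => βh (m + σ • x) i - b) 2 (stdGaussian (EuclideanSpace ℝ (Fin n))) := by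
  have h2 : LipschitzWith ‖σ‖₊ fun x : EuclideanSpace ℝ (Fin n) => m + σ • x :=
    LipschitzWith.of_dist_le_mul fun x y => by
      rw [dist_add_left, dist_smul₀, coe_nnnorm]
  exact (memLp_two_of_lipschitzWith ((lipschitzWith_euclideanSpace_apply hC i).comp h2)).sub
    (memLp_const b)

theorem memLp_two_inner (u : EuclideanSpace ℝ (Fin n)) :
    MemLp (fun x => ⟪u, x⟫) 2 (stdGaussian (EuclideanSpace ℝ (Fin n))) :=
  memLp_two_of_lipschitzWith (innerSL ℝ u).lipschitz

theorem olse_response (hX : IsUnit (gram X).det) (β : EuclideanSpace ℝ (Fin p)) (σ : ℝ)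
    (x : EuclideanSpace ℝ (Fin n)) (i : Fin p) :
    olse X (fit X β + σ • x) i = β i + σ / n * ⟪dualDir X i, x⟫ := by
  rw [olse_apply, inner_add_right, mul_add, inner_dualDir_fit hX, inner_smul_right]
  ring

/-- The mean squared error identity for products of coordinates, in terms of the Jacobian. -/
theorem integral_coord_mul_coord {C : ℝ≥0} (hC : LipschitzWith C βh) (hX : IsUnit (gram X).det)
    (β : EuclideanSpace ℝ (Fin p)) (σ : ℝ) (i j : Fin p) :
    Integrable (fun x => (βh (fit X β + σ • x) - β) i * (βh (fit X β + σ • x) - β) j)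
        (stdGaussian _) ∧
      Integrable (fun x => (βh (fit X β + σ • x) - olse X (fit X β + σ • x)) i *
        (βh (fit X β + σ • x) - olse X (fit X β + σ • x)) j) (stdGaussian _) ∧
      ∫ x, (βh (fit X β + σ • x) - β) i * (βh (fit X β + σ • x) - β) j ∂(stdGaussian _) =
        ∫ x, (βh (fit X β + σ • x) - olse X (fit X β + σ • x)) i *
          (βh (fit X β + σ • x) - olse X (fit X β + σ • x)) j ∂(stdGaussian _) +
        σ ^ 2 / n * ∫ x, jac X βh (fit X β + σ • x) i j ∂(stdGaussian _) +
        σ ^ 2 / n * ∫ x, jac X βh (fit X β + σ • x) j i ∂(stdGaussian _) -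
        σ ^ 2 / n * (gram X)⁻¹ i j := by
  set m := fit X β with hm
  set γ := stdGaussian (EuclideanSpace ℝ (Fin n)) with hγ
  set d : Fin p → EuclideanSpace ℝ (Fin n) → ℝ := fun i x => βh (m + σ • x) i - β i with hd
  set e : Fin p → EuclideanSpace ℝ (Fin n) → ℝ := fun i x => ⟪dualDir X i, x⟫ with he
  have hd2 : ∀ i, MemLp (d i) 2 γ := fun i => memLp_two_coord hC m σ (β i) i
  have he2 : ∀ i, MemLp (e i) 2 γ := fun i => memLp_two_inner _
  have h1 : ∀ i x, (βh (m + σ • x) - β) i = d i x := fun i x => rfl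
  have h2 : ∀ i x, (βh (m + σ • x) - olse X (m + σ • x)) i = d i x - σ / n * e i x := by
    intro i x
    rw [PiLp.sub_apply, hm, olse_response hX]
    simp only [hd, he]
    ring
  simp only [h1, h2]
  have hdd := (hd2 i).integrable_mul (hd2 j)
  have hde := (hd2 i).integrable_mul (he2 j)
  have hed := (hd2 j).integrable_mul (he2 i)
  have hee := (he2 i).integrable_mul (he2 j)
  have hexp : (fun x => (d i x - σ / n * e i x) * (d j x - σ / n * e j x)) = fun x =>
      (d i * d j) x - σ / n * (d i * e j) x - σ / n * (d j * e i) x +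
        (σ / n) ^ 2 * (e i * e j) x := by
    funext x
    simp only [Pi.mul_apply]
    ring
  have hA₀ : Integrable (fun x => (d i * d j) x - σ / n * (d i * e j) x) γ :=
    hdd.sub (hde.const_mul (σ / n))
  have hA : Integrable (fun x => (d i * d j) x - σ / n * (d i * e j) x -
      σ / n * (d j * e i) x) γ := hA₀.sub (hed.const_mul (σ / n))
  have hB := hee.const_mul ((σ / n) ^ 2)
  refine ⟨hdd, ?_, ?_⟩
  · rw [hexp]
    exact hA.add hB
  · have hI : ∫ x, (d i x - σ / n * e i x) * (d j x - σ / n * e j x) ∂γ =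
        ∫ x, (d i * d j) x ∂γ - σ / n * ∫ x, (d i * e j) x ∂γ - σ / n * ∫ x, (d j * e i) x ∂γ +
          (σ / n) ^ 2 * ∫ x, (e i * e j) x ∂γ := by
      rw [hexp, integral_add hA hB, integral_sub hA₀ (hed.const_mul _),
        integral_sub hdd (hde.const_mul _), integral_const_mul, integral_const_mul,
        integral_const_mul]
    rw [hI]
    have hS : ∀ i l, ∫ x, (d i * e l) x ∂γ = σ * ∫ x, jac X βh (m + σ • x) i l ∂γ :=
      fun i l => integral_mul_inner_dualDir hC m σ (β i) i l
    -- By `inner_dualDir_dualDir`, `(σ/n)²` times this is the covariance `σ²/n Σ⁻¹` of ordinary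
    -- least squares. Each cross term contributes `-σ²/n` times a mean Jacobian entry.
    have hE : ∫ x, (e i * e j) x ∂γ = ⟪dualDir X j, dualDir X i⟫ :=
      integral_inner_mul_inner_stdGaussian _ _
    rw [hS, hS, hE, ← inner_dualDir_dualDir hX, real_inner_comm]
    simp only [Pi.mul_apply]
    ring

/-- Under the response distribution, `P̂ᵀ Q⁻¹ P̂` is almost surely the Jacobian. -/
theorem ae_response_isUnit_and_sandwich_eq (hX : IsUnit (gram X).det) (hρ : IsPenalty ρ lam)
    (hρ₂ : IsAlmostSecondDeriv ρ ρ₂) (hlam : 0 < lam) (hconv : SparseConvex X ρ p)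
    (hβ : ∀ v, IsPenLSE X ρ v (βh v)) (m : EuclideanSpace ℝ (Fin n)) {σ : ℝ} (hσ : σ ≠ 0) :
    ∀ᵐ x ∂(stdGaussian (EuclideanSpace ℝ (Fin n))),
      IsUnit (Q X ρ₂ (βh (m + σ • x))).det ∧
        sandwich X ρ₂ (βh (m + σ • x)) = jac X βh (m + σ • x) := by
  obtain ⟨k, c, hkc, hk, hc⟩ := hconv.exists_bounds
  exact ae_stdGaussian_add_smul
    (ae_isUnit_det_Q_and_sandwich_eq hX hρ hρ₂ hlam hkc hk hc hβ) m hσ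

/-- Almost everywhere equal to the bounded measurable Jacobian when `σ ≠ 0`, and constant when `σ =
0`. -/
theorem integrable_sandwich (hX : IsUnit (gram X).det) (hρ : IsPenalty ρ lam)
    (hρ₂ : IsAlmostSecondDeriv ρ ρ₂) (hlam : 0 < lam) (hconv : SparseConvex X ρ p)
    (hβ : ∀ v, IsPenLSE X ρ v (βh v)) (m : EuclideanSpace ℝ (Fin n)) (σ : ℝ) (i j : Fin p) :
    Integrable (fun x => sandwich X ρ₂ (βh (m + σ • x)) i j)
      (stdGaussian (EuclideanSpace ℝ (Fin n))) := by
  obtain ⟨k, c, hkc, hk, hc⟩ := hconv.exists_bounds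
  obtain ⟨C, hC⟩ := lipschitzWith_of_isPenLSE hρ hlam hkc hk hc hβ
  by_cases hσ : σ = 0
  · simp [hσ]
  · refine (integrable_jac (X := X) hC m σ i j).congr ?_
    filter_upwards [ae_response_isUnit_and_sandwich_eq hX hρ hρ₂ hlam hconv hβ m hσ] with x hx
    rw [hx.2]

/-- The mean squared error identity for products of coordinates. -/
theorem integral_coord_mul_coord_eq_sandwich (hX : IsUnit (gram X).det) (hρ : IsPenalty ρ lam)
    (hρ₂ : IsAlmostSecondDeriv ρ ρ₂) (hlam : 0 < lam) (hconv : SparseConvex X ρ p)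
    (hβ : ∀ v, IsPenLSE X ρ v (βh v)) (β : EuclideanSpace ℝ (Fin p)) (σ : ℝ) (i j : Fin p) :
    Integrable (fun x => (βh (fit X β + σ • x) - β) i * (βh (fit X β + σ • x) - β) j)
        (stdGaussian _) ∧
      Integrable (fun x => (βh (fit X β + σ • x) - olse X (fit X β + σ • x)) i *
        (βh (fit X β + σ • x) - olse X (fit X β + σ • x)) j) (stdGaussian _) ∧
      ∫ x, (βh (fit X β + σ • x) - β) i * (βh (fit X β + σ • x) - β) j ∂(stdGaussian _) =
        ∫ x, (βh (fit X β + σ • x) - olse X (fit X β + σ • x)) i *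
          (βh (fit X β + σ • x) - olse X (fit X β + σ • x)) j ∂(stdGaussian _) +
        2 * σ ^ 2 / n * ∫ x, sandwich X ρ₂ (βh (fit X β + σ • x)) i j ∂(stdGaussian _) -
        σ ^ 2 / n * (gram X)⁻¹ i j := by
  obtain ⟨k, c, hkc, hk, hc⟩ := hconv.exists_bounds
  obtain ⟨C, hC⟩ := lipschitzWith_of_isPenLSE hρ hlam hkc hk hc hβ
  obtain ⟨h1, h2, h3⟩ := integral_coord_mul_coord hC hX β σ i j
  refine ⟨h1, h2, ?_⟩
  rw [h3]
  -- For `σ = 0` the response is a single point, where the Jacobian formula may fail; the factor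
  -- `σ²` removes both terms.
  by_cases hσ : σ = 0
  · simp [hσ]
  · have hae := ae_response_isUnit_and_sandwich_eq hX hρ hρ₂ hlam hconv hβ (fit X β) hσ
    have h4 : ∫ x, jac X βh (fit X β + σ • x) i j ∂(stdGaussian _) =
        ∫ x, sandwich X ρ₂ (βh (fit X β + σ • x)) i j ∂(stdGaussian _) :=
      integral_congr_ae (by filter_upwards [hae] with x hx; rw [hx.2])
    have h5 : ∫ x, jac X βh (fit X β + σ • x) j i ∂(stdGaussian _) =
        ∫ x, sandwich X ρ₂ (βh (fit X β + σ • x)) i j ∂(stdGaussian _) :=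
      integral_congr_ae (by
        filter_upwards [hae] with x hx
        rw [← hx.2]
        exact sandwich_apply_comm _ j i)
    rw [h4, h5]
    ring

/-- An admissible variance estimator is unbiased and uncorrelated with `P̂ᵀ Q⁻¹ P̂`. -/
theorem IsVarEstimator.integral_mul_sandwich {β : EuclideanSpace ℝ (Fin p)} {σ : ℝ}
    {s : EuclideanSpace ℝ (Fin n) → ℝ} (hs : IsVarEstimator X σ s)
    (hX : IsUnit (gram X).det) (hρ : IsPenalty ρ lam)
    (hρ₂ : IsAlmostSecondDeriv ρ ρ₂) (hlam : 0 < lam) (hconv : SparseConvex X ρ p)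
    (hβ : ∀ v, IsPenLSE X ρ v (βh v)) (i j : Fin p) :
    Integrable (fun x => s (fit X β + σ • x)) (stdGaussian _) ∧
      ∫ x, s (fit X β + σ • x) ∂(stdGaussian _) = σ ^ 2 ∧
      Integrable (fun x => s (fit X β + σ • x) * sandwich X ρ₂ (βh (fit X β + σ • x)) i j)
        (stdGaussian _) ∧
      ∫ x, s (fit X β + σ • x) * sandwich X ρ₂ (βh (fit X β + σ • x)) i j ∂(stdGaussian _) =
        σ ^ 2 * ∫ x, sandwich X ρ₂ (βh (fit X β + σ • x)) i j ∂(stdGaussian _) := by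
  have hT := integrable_sandwich hX hρ hρ₂ hlam hconv hβ (fit X β) σ i j
  rcases hs with hs | ⟨hpn, hs⟩
  · simp only [hs]
    exact ⟨integrable_const _, by simp, hT.const_mul _, integral_const_mul _ _⟩
  have hnp : (0 : ℝ) < (n : ℝ) - p := sub_pos.2 (by exact_mod_cast hpn)
  have hs' : ∀ x, s (fit X β + σ • x) = σ ^ 2 / ((n : ℝ) - p) * ‖residL X x‖ ^ 2 := by
    intro x
    rw [hs, ← residL_apply, residL_fit_add_smul hX, norm_smul, mul_pow, Real.norm_eq_abs, sq_abs]
    ring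
  simp only [hs']
  have hI := (integrable_norm_residL_sq (X := X)).const_mul (σ ^ 2 / ((n : ℝ) - p))
  have hE : ∫ x, σ ^ 2 / ((n : ℝ) - p) * ‖residL X x‖ ^ 2 ∂(stdGaussian _) = σ ^ 2 := by
    rw [integral_const_mul, integral_norm_residL_sq hX, div_mul_cancel₀ _ hnp.ne']
  refine ⟨hI, hE, ?_⟩
  by_cases hσ : σ = 0
  · simp [hσ]
  obtain ⟨k, c, hkc, hk, hc⟩ := hconv.exists_bounds
  obtain ⟨C, hC⟩ := lipschitzWith_of_isPenLSE hρ hlam hkc hk hc hβ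
  have hu := existsUnique_isPenLSE hρ hlam hX hconv
  have hindep : IndepFun (residL X) (hatL X) (stdGaussian (EuclideanSpace ℝ (Fin n))) := by
    refine (indepFun_stdGaussian _ _ fun z => ?_).symm
    have hadj : (residL X).adjoint z = residL X z := by
      refine ext_inner_right ℝ fun w => ?_
      rw [ContinuousLinearMap.adjoint_inner_left, inner_residL_comm]
    rw [hadj, residL_apply, ← hatL_apply, map_sub, hatL_hatL hX, sub_self]
  -- The Jacobian sees the noise only through `hatL X x`, which is independent of the residual.
  have hjac : ∀ x, jac X βh (fit X β + σ • x) = jac X βh (fit X β + σ • hatL X x) := by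
    intro x
    rw [← jac_hatL hX hu hβ, map_add, map_smul, hatL_fit hX]
  have hind : IndepFun (fun x => σ ^ 2 / ((n : ℝ) - p) * ‖residL X x‖ ^ 2)
      (fun x => jac X βh (fit X β + σ • x) i j) (stdGaussian (EuclideanSpace ℝ (Fin n))) := by
    rw [show (fun x => jac X βh (fit X β + σ • x) i j) =
      fun x => jac X βh (fit X β + σ • hatL X x) i j from funext fun x => by rw [hjac x]]
    exact hindep.comp (φ := fun r => σ ^ 2 / ((n : ℝ) - p) * ‖r‖ ^ 2)
      (ψ := fun w => jac X βh (fit X β + σ • w) i j) (by fun_prop)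
      ((measurable_jac i j).comp (by fun_prop))
  have hJ := integrable_jac (X := X) hC (fit X β) σ i j
  have hae := ae_response_isUnit_and_sandwich_eq hX hρ hρ₂ hlam hconv hβ (fit X β) hσ
  -- Independence is used for the Jacobian, which is measurable, and transferred to `sandwich` by
  -- almost sure equality.
  have hcongr : (fun x => σ ^ 2 / ((n : ℝ) - p) * ‖residL X x‖ ^ 2 *
      sandwich X ρ₂ (βh (fit X β + σ • x)) i j) =ᵐ[stdGaussian _]
      fun x => σ ^ 2 / ((n : ℝ) - p) * ‖residL X x‖ ^ 2 * jac X βh (fit X β + σ • x) i j := by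
    filter_upwards [hae] with x hx
    rw [hx.2]
  refine ⟨(hind.integrable_mul hI hJ).congr hcongr.symm, ?_⟩
  rw [integral_congr_ae hcongr, hind.integral_fun_mul_eq_mul_integral hI.aestronglyMeasurable
    hJ.aestronglyMeasurable, hE]
  congr 1
  exact integral_congr_ae (by filter_upwards [hae] with x hx; rw [hx.2])

end Moments

/-! ### Both risk estimators as combinations of entrywise ones. -/

section Estimators

theorem abs_dotProduct_sq (a u : Fin p → ℝ) :
    |a ⬝ᵥ u| ^ 2 = ∑ i, ∑ j, a i * a j * (u i * u j) := by
  rw [sq_abs, sq, dotProduct, Finset.sum_mul_sum]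
  refine Finset.sum_congr rfl fun i _ => Finset.sum_congr rfl fun j _ => ?_
  ring

theorem dotProduct_mulVec_eq_sum (a : Fin p → ℝ) (M : Matrix (Fin p) (Fin p) ℝ) :
    a ⬝ᵥ M.mulVec a = ∑ i, ∑ j, a i * a j * M i j := by
  simp only [dotProduct, Matrix.mulVec, Finset.mul_sum]
  refine Finset.sum_congr rfl fun i _ => Finset.sum_congr rfl fun j _ => ?_
  ring

/-- The estimator of the `(i, j)` entry of the mean squared error matrix. -/
noncomputable def mseEntry (X : Matrix (Fin n) (Fin p) ℝ) (ρ₂ : ℝ → ℝ)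
    (βh : EuclideanSpace ℝ (Fin n) → EuclideanSpace ℝ (Fin p))
    (s : EuclideanSpace ℝ (Fin n) → ℝ) (i j : Fin p) (y : EuclideanSpace ℝ (Fin n)) : ℝ :=
  (βh y - olse X y) i * (βh y - olse X y) j + 2 / n * (s y * sandwich X ρ₂ (βh y) i j) -
    (gram X)⁻¹ i j / n * s y

theorem linMseEst_eq_sum (s : EuclideanSpace ℝ (Fin n) → ℝ) (a : Fin p → ℝ)
    (y : EuclideanSpace ℝ (Fin n)) :
    linMseEst X ρ₂ βh s a y = ∑ i, ∑ j, a i * a j * mseEntry X ρ₂ βh s i j y := by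
  rw [linMseEst, dotProduct_sandwich_mulVec, abs_dotProduct_sq, dotProduct_mulVec_eq_sum,
    dotProduct_mulVec_eq_sum]
  simp only [Finset.mul_sum, ← Finset.sum_add_distrib, ← Finset.sum_sub_distrib, mseEntry]
  refine Finset.sum_congr rfl fun i _ => Finset.sum_congr rfl fun j _ => ?_
  ring

theorem totMseEst_eq_sum (s : EuclideanSpace ℝ (Fin n) → ℝ) (y : EuclideanSpace ℝ (Fin n)) :
    totMseEst X ρ₂ βh s y = ∑ i, mseEntry X ρ₂ βh s i i y := by
  rw [totMseEst, ← trace_sandwich, EuclideanSpace.real_norm_sq_eq, Matrix.trace, Matrix.trace]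
  simp only [Finset.mul_sum, ← Finset.sum_add_distrib, ← Finset.sum_sub_distrib, mseEntry,
    Matrix.diag_apply]
  refine Finset.sum_congr rfl fun i _ => ?_
  ring

theorem integral_mseEntry {β : EuclideanSpace ℝ (Fin p)} {σ : ℝ}
    {s : EuclideanSpace ℝ (Fin n) → ℝ} (hs : IsVarEstimator X σ s)
    (hX : IsUnit (gram X).det) (hρ : IsPenalty ρ lam)
    (hρ₂ : IsAlmostSecondDeriv ρ ρ₂) (hlam : 0 < lam) (hconv : SparseConvex X ρ p)
    (hβ : ∀ v, IsPenLSE X ρ v (βh v)) (i j : Fin p) :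
    Integrable (fun x => mseEntry X ρ₂ βh s i j (fit X β + σ • x)) (stdGaussian _) ∧
      ∫ x, mseEntry X ρ₂ βh s i j (fit X β + σ • x) ∂(stdGaussian _) =
        ∫ x, (βh (fit X β + σ • x) - β) i * (βh (fit X β + σ • x) - β) j ∂(stdGaussian _) := by
  obtain ⟨-, h2, h3⟩ := integral_coord_mul_coord_eq_sandwich hX hρ hρ₂ hlam hconv hβ β σ i j
  obtain ⟨h4, h5, h6, h7⟩ := hs.integral_mul_sandwich (β := β) hX hρ hρ₂ hlam hconv hβ i j
  have hA : Integrable (fun x => (βh (fit X β + σ • x) - olse X (fit X β + σ • x)) i *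
      (βh (fit X β + σ • x) - olse X (fit X β + σ • x)) j +
      2 / n * (s (fit X β + σ • x) * sandwich X ρ₂ (βh (fit X β + σ • x)) i j)) (stdGaussian _) :=
    h2.add (h6.const_mul (2 / (n : ℝ)))
  have hB := h4.const_mul ((gram X)⁻¹ i j / n)
  refine ⟨hA.sub hB, ?_⟩
  rw [h3]
  simp only [mseEntry]
  rw [integral_sub hA hB, integral_add h2 (h6.const_mul _), integral_const_mul,
    integral_const_mul, h5, h7]
  ring

end Estimators

end PenLSE

/-! ### The theorem, by transfer to the given probability space. -/

open PenLSE

theorem theorem7 {n p : ℕ} (X : Matrix (Fin n) (Fin p) ℝ) (β : EuclideanSpace ℝ (Fin p))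
    (σ : ℝ) (hσ : 0 ≤ σ)
    (lam : ℝ) (hlam : 0 < lam) (ρ ρ₂ : ℝ → ℝ)
    (hρ : IsPenalty ρ lam) (hρ₂ : IsAlmostSecondDeriv ρ ρ₂)
    (hX : IsUnit (gram X).det)
    (hconv : SparseConvex X ρ p)
    {Ω : Type*} [MeasurableSpace Ω] (P : Measure Ω) [IsProbabilityMeasure P]
    (ε : Ω → EuclideanSpace ℝ (Fin n))
    (hε : HasLaw ε (multivariateGaussian 0 (σ ^ 2 • (1 : Matrix (Fin n) (Fin n) ℝ))) P)
    (y : Ω → EuclideanSpace ℝ (Fin n)) (hy : ∀ ω, y ω = fit X β + ε ω) :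
    (∀ v : EuclideanSpace ℝ (Fin n), ∃! b : EuclideanSpace ℝ (Fin p), IsPenLSE X ρ v b) ∧
    ∀ βh : EuclideanSpace ℝ (Fin n) → EuclideanSpace ℝ (Fin p),
      (∀ v, IsPenLSE X ρ v (βh v)) →
      (0 < σ → ∀ᵐ ω ∂P, IsUnit (Q X ρ₂ (βh (y ω))).det) ∧
      (MatIntegrable P (fun ω => outer (βh (y ω) - β)) ∧
        MatIntegrable P (fun ω => outer (βh (y ω) - olse X (y ω))) ∧
        MatIntegrable P (fun ω =>
          (proj (βh (y ω))).transpose * (Q X ρ₂ (βh (y ω)))⁻¹ * proj (βh (y ω))) ∧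
        matExp P (fun ω => outer (βh (y ω) - β)) =
          matExp P (fun ω => outer (βh (y ω) - olse X (y ω)) +
            (2 * σ ^ 2 / n) •
              ((proj (βh (y ω))).transpose * (Q X ρ₂ (βh (y ω)))⁻¹ * proj (βh (y ω)))) -
          (σ ^ 2 / n) • (gram X)⁻¹) ∧
      ∀ s : EuclideanSpace ℝ (Fin n) → ℝ, IsVarEstimator X σ s →
        (∀ a : Fin p → ℝ,
          Integrable (fun ω => |a ⬝ᵥ (βh (y ω) - β).ofLp| ^ 2) P ∧
          Integrable (fun ω => linMseEst X ρ₂ βh s a (y ω)) P ∧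
          ∫ ω, linMseEst X ρ₂ βh s a (y ω) ∂P = ∫ ω, |a ⬝ᵥ (βh (y ω) - β).ofLp| ^ 2 ∂P) ∧
        (Integrable (fun ω => ‖βh (y ω) - β‖ ^ 2) P ∧
          Integrable (fun ω => totMseEst X ρ₂ βh s (y ω)) P ∧
          ∫ ω, totMseEst X ρ₂ βh s (y ω) ∂P = ∫ ω, ‖βh (y ω) - β‖ ^ 2 ∂P) := by
  refine ⟨existsUnique_isPenLSE hρ hlam hX hconv, fun βh hβ => ?_⟩
  rw [multivariateGaussian_smul_one] at hε
  have hmom := fun i j => integral_coord_mul_coord_eq_sandwich hX hρ hρ₂ hlam hconv hβ β σ i j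
  have hT := fun i j => integrable_comp_response hε (fit X β) hy
    (G := fun v => sandwich X ρ₂ (βh v) i j)
    (integrable_sandwich hX hρ hρ₂ hlam hconv hβ (fit X β) σ i j)
  have hM := fun i j => integrable_comp_response hε (fit X β) hy
    (G := fun v => (βh v - β) i * (βh v - β) j) (hmom i j).1
  have hD := fun i j => integrable_comp_response hε (fit X β) hy
    (G := fun v => (βh v - olse X v) i * (βh v - olse X v) j) (hmom i j).2.1
  refine ⟨fun hσ0 => ?_, ⟨fun i j => (hM i j).1, fun i j => (hD i j).1, fun i j => (hT i j).1, ?_⟩,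
    fun s hs => ?_⟩
  · have hξ := hasLaw_inv_smul hσ0.ne' hε
    have hae := ae_response_isUnit_and_sandwich_eq hX hρ hρ₂ hlam hconv hβ (fit X β) hσ0.ne'
    rw [← hξ.map_eq] at hae
    filter_upwards [ae_of_ae_map hξ.aemeasurable hae] with ω hω
    have h1 := hω.1
    rwa [smul_smul, mul_inv_cancel₀ hσ0.ne', one_smul, ← hy] at h1
  · ext i j
    change ∫ ω, (βh (y ω) - β) i * (βh (y ω) - β) j ∂P =
      ∫ ω, ((βh (y ω) - olse X (y ω)) i * (βh (y ω) - olse X (y ω)) j +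
        2 * σ ^ 2 / n * sandwich X ρ₂ (βh (y ω)) i j) ∂P - σ ^ 2 / n * (gram X)⁻¹ i j
    rw [integral_add (hD i j).1 ((hT i j).1.const_mul _), integral_const_mul, (hM i j).2,
      (hD i j).2, (hT i j).2, (hmom i j).2.2]
  · have hG : ∀ i j, Integrable (fun ω => mseEntry X ρ₂ βh s i j (y ω)) P ∧
        ∫ ω, mseEntry X ρ₂ βh s i j (y ω) ∂P = ∫ ω, (βh (y ω) - β) i * (βh (y ω) - β) j ∂P := by
      intro i j
      obtain ⟨h1, h2⟩ := integral_mseEntry (β := β) hs hX hρ hρ₂ hlam hconv hβ i j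
      obtain ⟨h3, h4⟩ := integrable_comp_response hε (fit X β) hy h1
      exact ⟨h3, by rw [h4, h2, (hM i j).2]⟩
    refine ⟨fun a => ?_, ?_⟩
    · simp only [linMseEst_eq_sum, abs_dotProduct_sq]
      refine ⟨integrable_finsetSum _ fun i _ => integrable_finsetSum _ fun j _ =>
          (hM i j).1.const_mul _,
        integrable_finsetSum _ fun i _ => integrable_finsetSum _ fun j _ =>
          (hG i j).1.const_mul _, ?_⟩
      rw [integral_finsetSum _ fun i _ => integrable_finsetSum _ fun j _ =>
          (hG i j).1.const_mul _,
        integral_finsetSum _ fun i _ => integrable_finsetSum _ fun j _ =>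
          (hM i j).1.const_mul _]
      refine Finset.sum_congr rfl fun i _ => ?_
      rw [integral_finsetSum _ fun j _ => (hG i j).1.const_mul _,
        integral_finsetSum _ fun j _ => (hM i j).1.const_mul _]
      refine Finset.sum_congr rfl fun j _ => ?_
      rw [integral_const_mul, integral_const_mul, (hG i j).2]
    · simp only [totMseEst_eq_sum, EuclideanSpace.real_norm_sq_eq]
      simp only [sq]
      refine ⟨integrable_finsetSum _ fun i _ => (hM i i).1,
        integrable_finsetSum _ fun i _ => (hG i i).1, ?_⟩
      rw [integral_finsetSum _ fun i _ => (hG i i).1, integral_finsetSum _ fun i _ => (hM i i).1]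
      exact Finset.sum_congr rfl fun i _ => (hG i i).2
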